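/- Let $2\le k$ and let $H=(V,E)$ be a hypergraph on $n$ vertices that is a star hypergraph of rank $k$: every hyperedge has exactly $k$ vertices, every vertex lies in at least one hyperedge, and there is a set $S\subseteq V$ with $|S|=k-1$ that is contained in every hyperedge. Let $F$ be a field of characteristic zero. For an integer $r\ge -1$ let $\Lambda_r$ be the set of ordered partitions $(B_1,\dots,B_{r+2})$ of $V$ into nonempty blocks such that at least one $B_i$ contains a hyperedge of $H$. Let $C_r$ be the $F$-vector space spanned by $\Lambda_r$ modulo the relations $(B_1,B_2,\dots,B_{r+2})=(-1)^{r+1}(B_2,\dots,B_{r+2},B_1)$, and write $[B_1,\dots,B_{r+2}]$ for the class of $(B_1,\dots,B_{r+2})$; put $C_r=0$ for $r\le -2$. Let $\partial_r\colon C_r\to C_{r-1}$ be given by $$\partial_r[B_1,\dots,B_{r+2}]=\sum_{i=1}^{r+1}(-1)^{i+1}[B_1,\dots,B_i\cup B_{i+1},\dots,B_{r+2}]+(-1)^{r+3}[B_1\cup B_{r+2},B_2,\dots,B_{r+1}]$$ for $r\ge 0$, and $\partial_{r}=0$ for $r\le -1$. This complex is the cyclic coloring complex $\Delta(H)$, and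 $HC_r(\Delta(H))=\ker\partial_r/\operatorname{im}\partial_{r+1}$. Then for every integer $r$ with $-1\le r\le n-k-1$, $$\dim_F HC_r(\Delta(H))=\binom{n-k+1}{r+1}.$$ -/

import Mathlib

namespace Hypergraph

universe u v

variable {α : Type u}

/-- `H` is uniform of rank `k`: every hyperedge has exactly `k` vertices. -/
def IsUniform (H : Hypergraph α) (k : ℕ) : Prop :=
  ∀ e ∈ H.edgeSet, e.encard = k

/-- `H` is a star hypergraph of rank `k`: it is `k`-uniform, it has no singleton (isolated)
vertices, that is, every vertex lies in a hyperedge, and all hyperedges contain a common set of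
`k - 1` vertices (the condition `S.encard + 1 = k` avoids natural-number subtraction). -/
structure IsStar (H : Hypergraph α) (k : ℕ) : Prop where
  uniform : H.IsUniform k
  no_singleton : ∀ v ∈ H.vertexSet, ∃ e ∈ H.edgeSet, v ∈ e
  common : ∃ S ⊆ H.vertexSet, S.encard + 1 = k ∧ ∀ e ∈ H.edgeSet, S ⊆ e

/-- An ordered partition `(B₁, …, Bₘ)` of the vertex set of `H` into `m` nonempty blocks, at least
one of which contains a hyperedge. It is recorded by the surjective function `block` that sends
a vertex to the index of its block, so that with indices starting from `0` the blocks are the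
fibres of `block`. The set `Λ_r` consists of those with `m = r + 2` blocks. -/
@[ext]
structure OrderedPartition (H : Hypergraph α) (m : ℕ) where
  /-- the index of the block containing a given vertex -/
  block : H.vertexSet → Fin m
  surjective : Function.Surjective block
  exists_edge : ∃ e ∈ H.edgeSet, ∃ i : Fin m, ∀ v : H.vertexSet, (v : α) ∈ e → block v = i

/-- Reindex the blocks along a surjection, taking unions of the blocks with the same new index. -/
def OrderedPartition.map {H : Hypergraph α} {m l : ℕ} (B : H.OrderedPartition m)
    (φ : Fin m → Fin l) (hφ : Function.Surjective φ) : H.OrderedPartition l where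
  block := φ ∘ B.block
  surjective := hφ.comp B.surjective
  exists_edge := by
    obtain ⟨e, he, i, hi⟩ := B.exists_edge
    exact ⟨e, he, φ i, fun v hv => congrArg φ (hi v hv)⟩

/-- The cyclic rotation `(B₁, B₂, …, Bₘ) ↦ (B₂, …, Bₘ, B₁)`. -/
def OrderedPartition.rotate {H : Hypergraph α} {m : ℕ} (B : H.OrderedPartition m) :
    H.OrderedPartition m :=
  B.map (finRotate m).symm (finRotate m).symm.surjective

/-- The change of block indices (starting from `0`) when block `i` is merged with the cyclically
next block: for `i ≤ m` the blocks `i` and `i + 1` get the common index `i`; for the last index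
`i = m + 1` the last block is merged into block `0`. -/
def mergeIndex {m : ℕ} (i j : Fin (m + 2)) : Fin (m + 1) :=
  ⟨if (j : ℕ) ≤ i then (if (j : ℕ) = m + 1 then 0 else j) else j - 1, by
    split_ifs <;> omega⟩

theorem mergeIndex_surjective {m : ℕ} (i : Fin (m + 2)) :
    Function.Surjective (mergeIndex i) := by
  intro t
  by_cases h : (t : ℕ) ≤ i
  · refine ⟨⟨t, by omega⟩, Fin.ext ?_⟩
    simp only [mergeIndex]
    split_ifs <;> omega
  · refine ⟨⟨t + 1, by omega⟩, Fin.ext ?_⟩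
    simp only [mergeIndex]
    split_ifs <;> omega

/-- With indices starting from `0`: for `i ≤ m` this is
`(B₀, …, Bᵢ ∪ Bᵢ₊₁, …, Bₘ₊₁)`, and for `i = m + 1` it is `(B₀ ∪ Bₘ₊₁, B₁, …, Bₘ)`. -/
def OrderedPartition.merge {H : Hypergraph α} {m : ℕ} (i : Fin (m + 2))
    (B : H.OrderedPartition (m + 2)) : H.OrderedPartition (m + 1) :=
  B.map (mergeIndex i) (mergeIndex_surjective i)

section Complex

variable (H : Hypergraph α) (F : Type v) [Field F]

/-- The relations `(B₁, …, Bₘ) = (-1) ^ (m - 1) (B₂, …, Bₘ, B₁)`; note that `m - 1` and `m + 1`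
have the same parity, and that `m - 1 = r + 1` when `m = r + 2`. -/
noncomputable def cyclicRelations (m : ℕ) : Submodule F (H.OrderedPartition m →₀ F) :=
  Submodule.span F (Set.range fun B : H.OrderedPartition m =>
    Finsupp.single B 1 - (-1 : F) ^ (m + 1) • Finsupp.single B.rotate 1)

/-- The space of cyclic chains on `m` blocks: the vector space spanned by the ordered partitions
into `m` blocks, some block of which contains a hyperedge, modulo the cyclic equivalence with
sign. This is `C_r` for `m = r + 2`. -/
abbrev CyclicChain (m : ℕ) : Type (max u v) :=
  (H.OrderedPartition m →₀ F) ⧸ H.cyclicRelations F m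

/-- The class `[B₁, …, Bₘ]` of an ordered partition. -/
noncomputable def cyclicClass {m : ℕ} (B : H.OrderedPartition m) : H.CyclicChain F m :=
  (H.cyclicRelations F m).mkQ (Finsupp.single B 1)

theorem cyclicClass_rotate {m : ℕ} (B : H.OrderedPartition m) :
    H.cyclicClass F B.rotate = (-1 : F) ^ (m + 1) • H.cyclicClass F B := by
  have h : H.cyclicClass F B = (-1 : F) ^ (m + 1) • H.cyclicClass F B.rotate := by
    rw [cyclicClass, cyclicClass, ← map_smul, ← sub_eq_zero, ← map_sub, Submodule.mkQ_apply,
      Submodule.Quotient.mk_eq_zero]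
    exact Submodule.subset_span ⟨B, rfl⟩
  rw [h, smul_smul, ← mul_pow]
  simp

/-- The boundary formula on ordered partitions. -/
noncomputable def boundaryAux (m : ℕ) :
    (H.OrderedPartition (m + 2) →₀ F) →ₗ[F] H.CyclicChain F (m + 1) :=
  Finsupp.linearCombination F fun B =>
    ∑ i : Fin (m + 2), (-1 : F) ^ (i : ℕ) • H.cyclicClass F (B.merge i)

theorem OrderedPartition.merge_castSucc_rotate {m : ℕ} (B : H.OrderedPartition (m + 2))
    (i : Fin (m + 1)) : B.rotate.merge i.castSucc = (B.merge i.succ).rotate := by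
  ext v : 2
  apply (finRotate (m + 1)).injective
  simp only [merge, rotate, map, Function.comp_apply, Equiv.apply_symm_apply]
  obtain ⟨j, hj⟩ := (finRotate (m + 2)).surjective (B.block v)
  rw [← hj, Equiv.symm_apply_apply]
  apply Fin.ext
  simp only [coe_finRotate, mergeIndex, Fin.ext_iff, Fin.val_last, Fin.val_castSucc,
    Fin.val_succ]
  split_ifs <;> omega

theorem OrderedPartition.merge_last_rotate {m : ℕ} (B : H.OrderedPartition (m + 2)) :
    B.rotate.merge (Fin.last (m + 1)) = B.merge 0 := by
  ext v : 2
  simp only [merge, rotate, map, Function.comp_apply]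
  obtain ⟨j, hj⟩ := (finRotate (m + 2)).surjective (B.block v)
  rw [← hj, Equiv.symm_apply_apply]
  apply Fin.ext
  simp only [coe_finRotate, mergeIndex, Fin.ext_iff, Fin.val_last, Fin.val_zero]
  split_ifs <;> omega

/-- The boundary formula is compatible with the cyclic equivalence. -/
theorem cyclicRelations_le_ker_boundaryAux (m : ℕ) :
    H.cyclicRelations F (m + 2) ≤ LinearMap.ker (H.boundaryAux F m) := by
  rw [cyclicRelations, Submodule.span_le]
  rintro _ ⟨B, rfl⟩
  simp only [SetLike.mem_coe, LinearMap.mem_ker, map_sub, map_smul, boundaryAux,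
    Finsupp.linearCombination_single, one_smul]
  rw [Fin.sum_univ_castSucc (f := fun i : Fin (m + 2) =>
    (-1 : F) ^ (i : ℕ) • H.cyclicClass F (B.rotate.merge i)), Fin.sum_univ_succ]
  simp only [OrderedPartition.merge_castSucc_rotate, OrderedPartition.merge_last_rotate,
    cyclicClass_rotate, smul_add, Finset.smul_sum, smul_smul]
  rw [sub_eq_zero]
  refine (add_comm _ _).trans (congrArg₂ (· + ·) (Finset.sum_congr rfl fun i _ => ?_) ?_)
  · congr 1
    simp only [Fin.val_succ, Fin.val_castSucc, ← pow_add]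
    rw [show m + 2 + 1 + (i + (m + 1 + 1)) = i + 1 + 2 * (m + 2) by ring, pow_add _ _ (2 * _),
      pow_mul]
    simp
  · congr 1
    simp only [Fin.val_zero, Fin.val_last, ← pow_add]
    rw [show m + 2 + 1 + (m + 1) = 2 * (m + 2) by ring, pow_mul]
    simp

/-- The boundary map from chains on `m + 1` blocks to chains on `m` blocks,
`[B₁, …, B_{r+2}] ↦ ∑_{i=1}^{r+1} (-1)^(i+1) [B₁, …, Bᵢ ∪ Bᵢ₊₁, …, B_{r+2}]
  + (-1)^(r+3) [B₁ ∪ B_{r+2}, B₂, …, B_{r+1}]`, and zero on chains with one block (`r = -1`). -/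
noncomputable def cyclicBoundary : (m : ℕ) → H.CyclicChain F (m + 1) →ₗ[F] H.CyclicChain F m
  | 0 => 0
  | m + 1 => (H.cyclicRelations F (m + 2)).liftQ (H.boundaryAux F m)
      (H.cyclicRelations_le_ker_boundaryAux F m)

theorem cyclicBoundary_cyclicClass {m : ℕ} (B : H.OrderedPartition (m + 2)) :
    H.cyclicBoundary F (m + 1) (H.cyclicClass F B) =
      ∑ i : Fin (m + 2), (-1 : F) ^ (i : ℕ) • H.cyclicClass F (B.merge i) := by
  simp [cyclicBoundary, cyclicClass, boundaryAux]

/-- The cycles among the chains on `m` blocks. -/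
noncomputable def cyclicCycles : (m : ℕ) → Submodule F (H.CyclicChain F m)
  | 0 => ⊤
  | m + 1 => LinearMap.ker (H.cyclicBoundary F m)

/-- The homology at the chains on `m` blocks: cycles modulo boundaries. -/
abbrev CyclicHomologyAtBlocks (m : ℕ) : Type (max u v) :=
  H.cyclicCycles F m ⧸
    (LinearMap.range (H.cyclicBoundary F m)).submoduleOf (H.cyclicCycles F m)

/-- The `r`-th homology `HC_r(Δ(H)) = ker ∂_r / im ∂_{r+1}` of the cyclic coloring complex `Δ(H)`
with coefficients in `F`; the chains of degree `r` have `r + 2` blocks. For `r ≤ -2` there are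
no such chains, in accordance with the fact that no ordered partition has zero blocks and
a block containing a hyperedge. -/
abbrev CyclicHomology (r : ℤ) : Type (max u v) :=
  H.CyclicHomologyAtBlocks F (r + 2).toNat

end Complex

end Hypergraph

/-! ### Chains of lists of blocks -/

/-! Let `S` be the common core and `β` the set of the `N = n - k + 1` other vertices. The hyperedges
are exactly the sets `S ∪ {v}` with `v ∈ β`, so a block contains a hyperedge iff it contains `S` and
one more vertex. Rotating the block with `S` to the front and then deleting `S` identifies the
cyclic chains on `m` blocks with the chains on ordered partitions of `β` into `m` nonempty blocks.
The boundary becomes `torusBoundary`, the alternating sum of unions of cyclically adjacent blocks.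

Geometrically, `(A, B₁, …, B_d)` is the open simplex in the torus `(ℝ/ℤ)^β` on which the coordinates
in `A` vanish and those in `Bᵢ` have a common value `tᵢ`, with `0 < t₁ < … < t_d < 1`. Since `A` is
nonempty, these cells fill the set where some coordinate vanishes, the `(N-1)`-skeleton of the
product cell structure. All cellular boundaries of that structure are zero, so for `d < N` the
homology in degree `d = r + 1` has one class for each `d`-subset of `β`.

The algebraic proof attaches to a `d`-subset `U` the cycle `fundamentalCycle U` of a coordinate
subtorus and the cocycle `torusCocycle U U.toList`, pulled back along the projection to the
coordinates in `U`. The two families are dual (`torusCocycle_fundamentalCycle`). The main point is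
that a cycle on which all these cocycles vanish is a boundary (`exists_torusBoundary_eq`). Filter by
the size of the first block: on lists with first block `A`, modulo larger first blocks,
`torusBoundary` is minus the non-cyclic `boundary` on ordered partitions of `Aᶜ`. This is the
complex of a cube modulo its boundary: it is exact below the top degree (`exists_boundary_eq`), and
a cycle in the top degree is determined by one coefficient (`eq_zero_of_boundary_eq_zero`), which is
a value of a cocycle. -/

namespace BlockList

open Finsupp

section Partitions

variable {β F : Type*} [Field F]

variable (β F) in
/-- Formal linear combinations of lists of blocks. -/
abbrev Chains := List (Finset β) →₀ F

/-- The basis chain given by a list of blocks. -/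
noncomputable abbrev basisChain (l : List (Finset β)) : Chains β F := single l 1

/-- Linear extension of a map defined on lists of blocks. -/
noncomputable abbrev extend (f : List (Finset β) → Chains β F) : Chains β F →ₗ[F] Chains β F :=
  linearCombination F f

theorem eq_of_mem_supported {M : Type*} [AddCommGroup M] [Module F M]
    {f g : Chains β F →ₗ[F] M} {s : Set (List (Finset β))}
    (h : ∀ l ∈ s, f (basisChain l) = g (basisChain l)) {x : Chains β F}
    (hx : x ∈ supported F F s) : f x = g x := by
  rw [supported_eq_span_single] at hx
  refine LinearMap.eqOn_span (s := (fun i => single i (1 : F)) '' s) ?_ hx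
  rintro _ ⟨l, hl, rfl⟩
  exact h l hl

theorem map_mem_of_mem_supported {M : Type*} [AddCommGroup M] [Module F M]
    {f : Chains β F →ₗ[F] M} {s : Set (List (Finset β))} {p : Submodule F M}
    (h : ∀ l ∈ s, f (basisChain l) ∈ p) {x : Chains β F}
    (hx : x ∈ supported F F s) : f x ∈ p := by
  rw [supported_eq_span_single] at hx
  have : Submodule.span F ((fun i => single i (1 : F)) '' s) ≤ p.comap f := by
    rw [Submodule.span_le]
    rintro _ ⟨l, hl, rfl⟩
    exact h l hl
  exact this hx

theorem eq_of_basisChain {M : Type*} [AddCommGroup M] [Module F M]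
    {f g : Chains β F →ₗ[F] M}
    (h : ∀ l, f (basisChain l) = g (basisChain l)) (x : Chains β F) : f x = g x :=
  eq_of_mem_supported (s := Set.univ) (fun l _ => h l) (by simp)

theorem extend_basisChain (f : List (Finset β) → Chains β F) (l : List (Finset β)) :
    extend f (basisChain l) = f l := by
  simp [extend]

/-- Put a block in front. -/
noncomputable def cons (a : Finset β) : Chains β F →ₗ[F] Chains β F :=
  extend fun l => basisChain (a :: l)

theorem cons_basisChain (a : Finset β) (l : List (Finset β)) :
    cons a (basisChain l : Chains β F) = basisChain (a :: l) :=
  extend_basisChain _ _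

/-- The signed sum of all insertions of the block `{u}` into a list. -/
noncomputable def shuffleList (u : β) : List (Finset β) → Chains β F
  | [] => basisChain [{u}]
  | b :: l => basisChain ({u} :: b :: l) - cons b (shuffleList u l)

/-- The signed sum of all insertions of the block `{u}`. -/
noncomputable def shuffle (u : β) : Chains β F →ₗ[F] Chains β F := extend (shuffleList u)

@[simp]
theorem shuffle_nil (u : β) :
    shuffle u (basisChain [] : Chains β F) = cons {u} (basisChain []) := by
  rw [cons_basisChain]
  exact extend_basisChain _ _

@[simp]
theorem shuffle_cons (u : β) (b : Finset β) (x : Chains β F) :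
    shuffle u (cons b x) = cons {u} (cons b x) - cons b (shuffle u x) := by
  refine eq_of_basisChain (f := shuffle u ∘ₗ cons b)
    (g := cons {u} ∘ₗ cons b - cons b ∘ₗ shuffle u) (fun l => ?_) x
  simp only [LinearMap.comp_apply, cons_basisChain, LinearMap.sub_apply, shuffle,
    extend_basisChain, shuffleList]

variable [DecidableEq β]

/-- Unite a block with the first block. -/
noncomputable def mergeHead (a : Finset β) : Chains β F →ₗ[F] Chains β F :=
  extend fun
    | [] => 0
    | b :: l => basisChain ((a ∪ b) :: l)

@[simp]
theorem mergeHead_nil (a : Finset β) : mergeHead a (basisChain [] : Chains β F) = 0 :=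
  extend_basisChain _ _

@[simp]
theorem mergeHead_cons (a b : Finset β) (x : Chains β F) :
    mergeHead a (cons b x) = cons (a ∪ b) x := by
  refine eq_of_basisChain (f := mergeHead a ∘ₗ cons b) (fun l => ?_) x
  simp only [LinearMap.comp_apply, cons_basisChain]
  exact extend_basisChain _ _

/-- The signed sum of all unions of two adjacent blocks of a list. -/
noncomputable def boundaryList : List (Finset β) → Chains β F
  | [] => 0
  | a :: l => mergeHead a (basisChain l) - cons a (boundaryList l)

/-- The signed sum of all unions of two adjacent blocks. -/
noncomputable def boundary : Chains β F →ₗ[F] Chains β F := extend boundaryList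

@[simp]
theorem boundary_nil : boundary (basisChain [] : Chains β F) = 0 :=
  extend_basisChain _ _

@[simp]
theorem boundary_cons (a : Finset β) (x : Chains β F) :
    boundary (cons a x) = mergeHead a x - cons a (boundary x) := by
  refine eq_of_basisChain (f := boundary ∘ₗ cons a) (g := mergeHead a - cons a ∘ₗ boundary)
    (fun l => ?_) x
  simp only [LinearMap.comp_apply, cons_basisChain, LinearMap.sub_apply, boundary,
    extend_basisChain, boundaryList]

/-- Separate `u` from its block, in all possible ways to insert `{u}` to the right of that
block. -/
noncomputable def homotopyList (u : β) : List (Finset β) → Chains β F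
  | [] => 0
  | a :: l =>
    if u ∈ a then if a = {u} then 0 else cons (a.erase u) (shuffle u (basisChain l))
    else -cons a (homotopyList u l)

/-- The linear extension of `homotopyList`. -/
noncomputable def homotopy (u : β) : Chains β F →ₗ[F] Chains β F := extend (homotopyList u)

@[simp]
theorem homotopy_nil (u : β) : homotopy u (basisChain [] : Chains β F) = 0 :=
  extend_basisChain _ _

theorem homotopy_cons_of_notMem {u : β} {a : Finset β} (h : u ∉ a) (x : Chains β F) :
    homotopy u (cons a x) = -cons a (homotopy u x) := by
  refine eq_of_basisChain (f := homotopy u ∘ₗ cons a)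
    (g := -(cons a ∘ₗ homotopy u : Chains β F →ₗ[F] Chains β F)) (fun l => ?_) x
  simp only [LinearMap.comp_apply, cons_basisChain, LinearMap.neg_apply, homotopy,
    extend_basisChain, homotopyList, if_neg h]

theorem homotopy_cons_of_mem {u : β} {a : Finset β} (h : u ∈ a) (h' : a ≠ {u})
    (x : Chains β F) : homotopy u (cons a x) = cons (a.erase u) (shuffle u x) := by
  refine eq_of_basisChain (f := homotopy u ∘ₗ cons a)
    (g := cons (a.erase u) ∘ₗ shuffle u) (fun l => ?_) x
  simp only [LinearMap.comp_apply, cons_basisChain, homotopy,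
    extend_basisChain, homotopyList, if_pos h, if_neg h']

theorem homotopy_cons_singleton (u : β) (x : Chains β F) :
    homotopy u (cons {u} x) = 0 := by
  refine eq_of_basisChain (f := homotopy u ∘ₗ cons {u}) (g := 0) (fun l => ?_) x
  simp [LinearMap.comp_apply, cons_basisChain, homotopy, homotopyList]

/-- Keep the lists that start with the block `a`, and remove this block. -/
noncomputable def uncons (a : Finset β) : Chains β F →ₗ[F] Chains β F :=
  extend fun
    | [] => 0
    | b :: l => if b = a then basisChain l else 0

@[simp]
theorem uncons_nil (a : Finset β) : uncons a (basisChain [] : Chains β F) = 0 :=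
  extend_basisChain _ _

@[simp]
theorem uncons_cons_self (a : Finset β) (x : Chains β F) : uncons a (cons a x) = x := by
  refine eq_of_basisChain (f := uncons a ∘ₗ cons a) (g := LinearMap.id) (fun l => ?_) x
  simp [cons_basisChain, uncons]

theorem uncons_cons_of_ne {a b : Finset β} (h : b ≠ a) (x : Chains β F) :
    uncons a (cons b x) = 0 := by
  refine eq_of_basisChain (f := uncons a ∘ₗ cons b) (g := 0) (fun l => ?_) x
  simp [cons_basisChain, uncons, h]

@[simp]
theorem mergeHead_mergeHead (a b : Finset β) (x : Chains β F) :
    mergeHead a (mergeHead b x) = mergeHead (a ∪ b) x := by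
  refine eq_of_basisChain (f := mergeHead a ∘ₗ mergeHead b) (fun l => ?_) x
  simp only [LinearMap.comp_apply]
  cases l with
  | nil => simp
  | cons c l => rw [← cons_basisChain]; simp [Finset.union_assoc]

theorem boundary_mergeHead (a : Finset β) (x : Chains β F) :
    boundary (mergeHead a x) = mergeHead a (boundary x) := by
  refine eq_of_basisChain (f := boundary ∘ₗ mergeHead a) (g := mergeHead a ∘ₗ boundary)
    (fun l => ?_) x
  simp only [LinearMap.comp_apply]
  cases l with
  | nil => simp
  | cons c l => rw [← cons_basisChain]; simp

theorem boundary_boundary (x : Chains β F) : boundary (boundary x) = 0 := by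
  refine eq_of_basisChain (f := boundary ∘ₗ boundary) (g := 0) (fun l => ?_) x
  simp only [LinearMap.comp_apply, LinearMap.zero_apply]
  induction l with
  | nil => simp
  | cons a l ih =>
    rw [← cons_basisChain, boundary_cons, map_sub, boundary_cons, ih, boundary_mergeHead]
    simp

/-- The union of `{u}` with a block `b` arises twice, from `{u}` just before and just after `b`,
with opposite signs. Only the unions not involving `{u}` survive. -/
theorem boundary_shuffle (u : β) (x : Chains β F) :
    boundary (shuffle u x) = -shuffle u (boundary x) := by
  refine eq_of_basisChain (f := boundary ∘ₗ shuffle u)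
    (g := -(shuffle u ∘ₗ boundary : Chains β F →ₗ[F] Chains β F)) (fun l => ?_) x
  simp only [LinearMap.comp_apply, LinearMap.neg_apply]
  induction l with
  | nil => simp
  | cons b t ih =>
    rw [← cons_basisChain]
    cases t with
    | nil => simp [Finset.union_comm]
    | cons c t =>
      rw [← cons_basisChain] at ih ⊢
      simp only [shuffle_cons, boundary_cons, mergeHead_cons, map_sub] at ih ⊢
      rw [← sub_eq_zero] at ih ⊢
      have := congrArg (cons b) ih
      simp only [map_sub, map_neg, map_zero] at this
      rw [Finset.union_comm b {u}]
      rw [← this]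
      abel

/-! ### Ordered set partitions as lists of blocks -/

/-- The blocks in the list are nonempty and form a partition of `U`. -/
def IsPartition : Finset β → List (Finset β) → Prop
  | U, [] => U = ∅
  | U, a :: l => a.Nonempty ∧ a ⊆ U ∧ IsPartition (U \ a) l

theorem IsPartition.length_le {U : Finset β} {l : List (Finset β)} (h : IsPartition U l) :
    l.length ≤ U.card := by
  induction l generalizing U with
  | nil => simp
  | cons a l ih =>
    obtain ⟨h1, h2, h3⟩ := h
    have := ih h3
    rw [Finset.card_sdiff_of_subset h2] at this
    have := Finset.card_le_card h2
    have := h1.card_pos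
    simp only [List.length_cons]
    omega

theorem IsPartition.merge {U a b : Finset β} {l : List (Finset β)}
    (h : IsPartition U (a :: b :: l)) : IsPartition U ((a ∪ b) :: l) := by
  obtain ⟨h1, h2, h3, h4, h5⟩ := h
  refine ⟨h1.mono Finset.subset_union_left,
    Finset.union_subset h2 (h4.trans Finset.sdiff_subset), ?_⟩
  rwa [sdiff_sdiff_left] at h5

variable (F) in
/-- The chains on partitions of `U` into `p` blocks. -/
noncomputable def partitionChains (U : Finset β) (p : ℕ) : Submodule F (Chains β F) :=
  supported F F {l | IsPartition U l ∧ l.length = p}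

theorem basisChain_mem {U : Finset β} {l : List (Finset β)} {p : ℕ} (h : IsPartition U l)
    (hp : l.length = p) : basisChain l ∈ partitionChains F U p :=
  single_mem_supported F 1 ⟨h, hp⟩

theorem partitionChains_eq_bot {U : Finset β} {p : ℕ} (h : U.card < p) :
    partitionChains F U p = ⊥ := by
  have : {l : List (Finset β) | IsPartition U l ∧ l.length = p} = ∅ := by
    ext l
    simp only [Set.mem_ofPred_eq, Set.mem_empty_iff_false, iff_false, not_and]
    intro hl hp
    have := hl.length_le
    omega
  rw [partitionChains, this, supported_empty]

theorem cons_mem {U a : Finset β} {p : ℕ} (ha : a.Nonempty) (haU : a ⊆ U) {x : Chains β F}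
    (hx : x ∈ partitionChains F (U \ a) p) : cons a x ∈ partitionChains F U (p + 1) := by
  refine map_mem_of_mem_supported (fun l hl => ?_) hx
  rw [cons_basisChain]
  exact basisChain_mem ⟨ha, haU, hl.1⟩ (by simp [hl.2])

theorem mergeHead_mem {U a : Finset β} {p : ℕ} (ha : a.Nonempty) (haU : a ⊆ U) {x : Chains β F}
    (hx : x ∈ partitionChains F (U \ a) p) : mergeHead a x ∈ partitionChains F U p := by
  refine map_mem_of_mem_supported (fun l hl => ?_) hx
  obtain ⟨h1, h2⟩ := hl
  cases l with
  | nil => simp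
  | cons b l =>
    rw [← cons_basisChain, mergeHead_cons, cons_basisChain]
    exact basisChain_mem (IsPartition.merge ⟨ha, haU, h1⟩) (by simpa using h2)

theorem boundary_basisChain_mem {U : Finset β} {l : List (Finset β)} (hl : IsPartition U l)
    {p : ℕ} (hp : l.length = p + 1) :
    boundary (basisChain l) ∈ partitionChains F U p := by
  induction l generalizing U p with
  | nil => simp
  | cons a l ih =>
    obtain ⟨h1, h2, h3⟩ := hl
    rw [← cons_basisChain, boundary_cons]
    refine sub_mem (mergeHead_mem h1 h2 (basisChain_mem h3 (by simpa using hp))) ?_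
    cases l with
    | nil => simp
    | cons b l =>
      obtain rfl : l.length + 1 = p := by simpa using hp
      exact cons_mem h1 h2 (ih h3 (by simp))

theorem boundary_mem {U : Finset β} {p : ℕ} {x : Chains β F}
    (hx : x ∈ partitionChains F U (p + 1)) : boundary x ∈ partitionChains F U p :=
  map_mem_of_mem_supported (fun _ hl => boundary_basisChain_mem hl.1 hl.2) hx

theorem shuffle_basisChain_mem {U : Finset β} {u : β} (hu : u ∉ U) {l : List (Finset β)}
    (hl : IsPartition U l) : shuffle u (basisChain l) ∈
      partitionChains F (insert u U) (l.length + 1) := by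
  have key : (insert u U) \ {u} = U := by
    rw [Finset.insert_sdiff_of_mem _ (by simp)]
    rw [Finset.sdiff_singleton_eq_erase, Finset.erase_eq_of_notMem hu]
  induction l generalizing U with
  | nil =>
    rw [shuffle_nil]
    refine cons_mem (by simp) (by simp) (basisChain_mem ?_ rfl)
    rwa [key]
  | cons b l ih =>
    have hl' := hl
    obtain ⟨h1, h2, h3⟩ := hl
    rw [← cons_basisChain, shuffle_cons]
    refine sub_mem (cons_mem (by simp) (by simp) ?_) (cons_mem h1
      (h2.trans (Finset.subset_insert _ _)) ?_)
    · rw [key, cons_basisChain]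
      exact basisChain_mem hl' rfl
    · rw [Finset.insert_sdiff_of_notMem _ (fun h => hu (h2 h))]
      have hu' : u ∉ U \ b := fun h => hu (Finset.sdiff_subset h)
      refine ih hu' h3 ?_
      rw [Finset.insert_sdiff_of_mem _ (by simp)]
      rw [Finset.sdiff_singleton_eq_erase, Finset.erase_eq_of_notMem hu']

theorem shuffle_mem {U : Finset β} {u : β} (hu : u ∉ U) {p : ℕ} {x : Chains β F}
    (hx : x ∈ partitionChains F U p) :
    shuffle u x ∈ partitionChains F (insert u U) (p + 1) := by
  refine map_mem_of_mem_supported (fun l hl => ?_) hx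
  rw [← hl.2]
  exact shuffle_basisChain_mem hu hl.1

theorem homotopy_basisChain_mem {U : Finset β} (u : β) {l : List (Finset β)}
    (hl : IsPartition U l) :
    homotopy u (basisChain l) ∈ partitionChains F U (l.length + 1) := by
  induction l generalizing U with
  | nil => simp
  | cons a l ih =>
    obtain ⟨h1, h2, h3⟩ := hl
    rw [← cons_basisChain]
    by_cases hu : u ∈ a
    · by_cases ha : a = {u}
      · rw [ha, homotopy_cons_singleton]
        exact zero_mem _
      · rw [homotopy_cons_of_mem hu ha]
        refine cons_mem ?_ ((Finset.erase_subset _ _).trans h2) ?_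
        · rw [Finset.nonempty_iff_ne_empty, Ne, Finset.erase_eq_empty_iff]
          simp [ha, h1.ne_empty]
        · have : U \ a.erase u = insert u (U \ a) := by
            ext v
            simp only [Finset.mem_sdiff, Finset.mem_erase, Finset.mem_insert]
            have := @h2 u
            grind
          rw [this]
          exact shuffle_basisChain_mem (by simp [hu]) h3
    · rw [homotopy_cons_of_notMem hu]
      exact neg_mem (cons_mem h1 h2 (ih h3))

theorem homotopy_mem {U : Finset β} (u : β) {p : ℕ} {x : Chains β F}
    (hx : x ∈ partitionChains F U p) : homotopy u x ∈ partitionChains F U (p + 1) := by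
  refine map_mem_of_mem_supported (fun l hl => ?_) hx
  rw [← hl.2]
  exact homotopy_basisChain_mem u hl.1

/-- Splitting `u` off its block and reuniting the two parts gives the list back; everything else
cancels as in `boundary_shuffle`. A block `{u}` cannot be split, and must be united with its left
neighbour first, so a list starting with `{u}` has to be excluded. -/
theorem boundary_homotopy_basisChain {U : Finset β} {u : β} (hu : u ∈ U) {l : List (Finset β)}
    (hl : IsPartition U l) (hd : l.head? ≠ some {u}) :
    boundary (homotopy u (basisChain l : Chains β F)) + homotopy u (boundary (basisChain l)) =
      basisChain l := by
  induction l generalizing U with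
  | nil => simp [IsPartition] at hl; simp [hl] at hu
  | cons a l ih =>
    obtain ⟨h1, h2, h3⟩ := hl
    have ha : a ≠ {u} := by simpa using hd
    rw [← cons_basisChain]
    by_cases hua : u ∈ a
    · rw [homotopy_cons_of_mem hua ha]
      simp only [boundary_cons, map_sub, boundary_shuffle, homotopy_cons_of_mem hua ha, map_neg]
      have hau : a.erase u ∪ {u} = a := by
        rw [Finset.union_comm, ← Finset.insert_eq, Finset.insert_erase hua]
      cases l with
      | nil => simp [hau]
      | cons b l =>
        obtain ⟨h4, h5, h6⟩ := h3
        have hub : u ∉ b := fun h => (Finset.mem_sdiff.1 (h5 h)).2 hua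
        have hne : a ∪ b ≠ {u} := by
          intro h
          obtain ⟨v, hv⟩ := h4
          have : v ∈ a ∪ b := Finset.mem_union_right _ hv
          rw [h, Finset.mem_singleton] at this
          exact hub (this ▸ hv)
        rw [← cons_basisChain]
        simp only [shuffle_cons, mergeHead_cons, map_sub, hau,
          homotopy_cons_of_mem (Finset.mem_union_left b hua) hne]
        rw [Finset.erase_union_distrib, Finset.erase_eq_of_notMem hub]
        abel
    · have huU : u ∈ U \ a := by simp [hu, hua]
      rw [homotopy_cons_of_notMem hua]
      simp only [boundary_cons, map_sub, map_neg, homotopy_cons_of_notMem hua]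
      cases l with
      | nil => simp only [IsPartition] at h3; simp [h3] at huU
      | cons b l =>
        by_cases hb : b = {u}
        -- The homotopy kills this list. Splitting `a ∪ {u}` restores it, and the remaining
        -- insertions cancel against those from the union of `{u}` with the block to its right.
        · subst hb
          have hne : a ∪ {u} ≠ {u} := by
            intro h
            obtain ⟨v, hv⟩ := h1
            have : v ∈ a ∪ {u} := Finset.mem_union_left _ hv
            rw [h, Finset.mem_singleton] at this
            exact hua (this ▸ hv)
          rw [← cons_basisChain]
          simp only [homotopy_cons_singleton, boundary_cons, map_sub, map_zero, mergeHead_cons,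
            homotopy_cons_of_mem (Finset.mem_union_right a (Finset.mem_singleton_self u)) hne]
          have hau : (a ∪ {u}).erase u = a := by
            rw [Finset.erase_union_distrib, Finset.erase_eq_of_notMem hua]
            simp
          rw [hau]
          cases l with
          | nil => simp
          | cons c l =>
            obtain ⟨-, -, h7, h8, -⟩ := h3
            have huc : u ∉ c := fun h => by simpa using h8 h
            have hne : {u} ∪ c ≠ {u} := by
              intro h
              obtain ⟨v, hv⟩ := h7
              have : v ∈ {u} ∪ c := Finset.mem_union_right _ hv
              rw [h, Finset.mem_singleton] at this
              exact huc (this ▸ hv)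
            have huc' : ({u} ∪ c).erase u = c := by
              rw [Finset.erase_union_distrib, Finset.erase_eq_of_notMem huc]
              simp
            rw [← cons_basisChain]
            simp only [shuffle_cons, mergeHead_cons, map_sub, huc',
              homotopy_cons_of_mem (Finset.mem_union_left c (Finset.mem_singleton_self u)) hne]
            abel
        · have := congrArg (cons a) (ih huU h3 (by simpa using hb))
          rw [map_add] at this
          rw [← this]
          obtain ⟨h4, h5, h6⟩ := h3
          rw [← cons_basisChain]
          by_cases hub : u ∈ b
          · have hne : a ∪ b ≠ {u} := by
              intro h
              obtain ⟨v, hv⟩ := h1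
              have : v ∈ a ∪ b := Finset.mem_union_left _ hv
              rw [h, Finset.mem_singleton] at this
              exact hua (this ▸ hv)
            simp only [boundary_cons, mergeHead_cons, map_sub, homotopy_cons_of_mem hub hb,
              homotopy_cons_of_mem (Finset.mem_union_right a hub) hne]
            rw [Finset.erase_union_distrib, Finset.erase_eq_of_notMem hua]
            abel
          · have : u ∉ a ∪ b := by simp [hua, hub]
            simp only [boundary_cons, mergeHead_cons, map_sub, homotopy_cons_of_notMem hub,
              homotopy_cons_of_notMem this, map_neg]
            abel

/-! ### Acyclicity of the complex of ordered set partitions below the top degree -/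

variable (F) in
/-- The chains on partitions of `U` into `p` blocks the first of which satisfies `P`. -/
noncomputable def headChains (U : Finset β) (p : ℕ) (P : Finset β → Prop) :
    Submodule F (Chains β F) :=
  supported F F {l | IsPartition U l ∧ l.length = p ∧ ∀ b ∈ l.head?, P b}

theorem headChains_le (U : Finset β) (p : ℕ) (P : Finset β → Prop) :
    headChains F U p P ≤ partitionChains F U p :=
  supported_mono fun _ hl => ⟨hl.1, hl.2.1⟩

theorem headChains_mono {U : Finset β} {p : ℕ} {P Q : Finset β → Prop}
    (h : ∀ b, P b → Q b) : headChains F U p P ≤ headChains F U p Q :=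
  supported_mono fun _ hl => ⟨hl.1, hl.2.1, fun b hb => h b (hl.2.2 b hb)⟩

theorem partitionChains_le_headChains {U : Finset β} {p : ℕ} {P : Finset β → Prop}
    (h : ∀ b : Finset β, b.Nonempty → P b) :
    partitionChains F U p ≤ headChains F U p P := by
  refine supported_mono fun l hl => ⟨hl.1, hl.2, fun b hb => h b ?_⟩
  cases l with
  | nil => simp at hb
  | cons c l =>
    obtain rfl : c = b := by simpa using hb
    exact hl.1.1

theorem basisChain_mem_headChains {U a : Finset β} {l : List (Finset β)} {p : ℕ}
    {P : Finset β → Prop} (h : IsPartition U (a :: l)) (hp : l.length + 1 = p) (ha : P a) :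
    basisChain (a :: l) ∈ headChains F U p P :=
  single_mem_supported F 1 ⟨h, by simpa using hp, by simpa using ha⟩

theorem partitionChains_zero {U : Finset β} (h : U ≠ ∅) : partitionChains F U 0 = ⊥ := by
  have : {l : List (Finset β) | IsPartition U l ∧ l.length = 0} = ∅ := by
    ext l
    simp only [Set.mem_ofPred_eq, Set.mem_empty_iff_false, iff_false, not_and]
    intro hl hp
    rw [List.length_eq_zero_iff] at hp
    subst hp
    exact h hl
  rw [partitionChains, this, supported_empty]

theorem ssubset_union {U a b : Finset β} (hb : b.Nonempty) (h : b ⊆ U \ a) : a ⊂ a ∪ b := by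
  refine Finset.ssubset_iff_subset_ne.2 ⟨Finset.subset_union_left, fun hab => ?_⟩
  obtain ⟨v, hv⟩ := hb
  have h1 : v ∈ a := hab ▸ Finset.mem_union_right a hv
  exact (Finset.mem_sdiff.1 (h hv)).2 h1

theorem mergeHead_mem_headChains {U a : Finset β} {p : ℕ} (ha : a.Nonempty) (haU : a ⊆ U)
    {x : Chains β F} (hx : x ∈ partitionChains F (U \ a) p) :
    mergeHead a x ∈ headChains F U p (a ⊂ ·) := by
  refine map_mem_of_mem_supported (fun l hl => ?_) hx
  obtain ⟨h1, h2⟩ := hl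
  cases l with
  | nil => simp
  | cons b l =>
    rw [← cons_basisChain, mergeHead_cons, cons_basisChain]
    exact basisChain_mem_headChains (IsPartition.merge ⟨ha, haU, h1⟩) h2
      (ssubset_union h1.1 h1.2.1)

theorem uncons_eq_zero {U a : Finset β} {p : ℕ} {P : Finset β → Prop} (ha : ¬ P a)
    {x : Chains β F} (hx : x ∈ headChains F U p P) : uncons a x = 0 := by
  refine eq_of_mem_supported (f := uncons a) (g := 0) (fun l hl => ?_) hx
  obtain ⟨-, -, h3⟩ := hl
  cases l with
  | nil => simp
  | cons b l =>
    rw [← cons_basisChain, uncons_cons_of_ne]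
    · rfl
    · rintro rfl
      exact ha (h3 _ (by simp))

theorem uncons_mem {U a : Finset β} {p : ℕ} {x : Chains β F}
    (hx : x ∈ partitionChains F U (p + 1)) : uncons a x ∈ partitionChains F (U \ a) p := by
  refine map_mem_of_mem_supported (fun l hl => ?_) hx
  obtain ⟨h1, h2⟩ := hl
  cases l with
  | nil => simp
  | cons b l =>
    rw [← cons_basisChain]
    by_cases hb : b = a
    · subst hb
      rw [uncons_cons_self]
      exact basisChain_mem h1.2.2 (by simpa using h2)
    · rw [uncons_cons_of_ne hb]
      exact zero_mem _

theorem uncons_apply (a : Finset β) (x : Chains β F) (l : List (Finset β)) :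
    uncons a x l = x (a :: l) := by
  refine eq_of_basisChain (f := lapply l ∘ₗ uncons a) (g := lapply (a :: l)) (fun t => ?_) x
  cases t with
  | nil => simp
  | cons b t =>
    rw [LinearMap.comp_apply, ← cons_basisChain]
    by_cases hb : b = a
    · subst hb
      rw [uncons_cons_self, cons_basisChain]
      simp [single_apply]
    · rw [uncons_cons_of_ne hb, cons_basisChain]
      simp [hb]

/-- A union involving the first block `b` makes it strictly larger, so it can produce `a` only from
`b ⊂ a`. Without such `b`, first block `a` comes only from unions inside the tail. -/
theorem uncons_boundary {U a : Finset β} {p : ℕ} {x : Chains β F}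
    (hx : x ∈ headChains F U p (¬ · ⊂ a)) :
    uncons a (boundary x) = -boundary (uncons a x) := by
  refine eq_of_mem_supported (f := uncons a ∘ₗ boundary)
    (g := -(boundary ∘ₗ uncons a : Chains β F →ₗ[F] Chains β F)) (fun l hl => ?_) hx
  obtain ⟨h1, -, h3⟩ := hl
  simp only [LinearMap.comp_apply, LinearMap.neg_apply]
  cases l with
  | nil => simp
  | cons b l =>
    have hb : ¬ b ⊂ a := h3 b (by simp)
    rw [← cons_basisChain, boundary_cons, map_sub,
      uncons_eq_zero hb (mergeHead_mem_headChains h1.1 h1.2.1 (basisChain_mem h1.2.2 rfl))]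
    by_cases hba : b = a
    · subst hba
      simp
    · simp [uncons_cons_of_ne hba]

theorem sub_cons_uncons_mem {U : Finset β} {p : ℕ} (a : Finset β) {x : Chains β F}
    (hx : x ∈ partitionChains F U p) :
    x - cons a (uncons a x) ∈ headChains F U p (· ≠ a) := by
  refine map_mem_of_mem_supported (f := LinearMap.id - cons a ∘ₗ uncons a) (fun l hl => ?_) hx
  obtain ⟨h1, h2⟩ := hl
  simp only [LinearMap.sub_apply, LinearMap.id_apply, LinearMap.comp_apply]
  cases l with
  | nil =>
    rw [uncons_nil, map_zero, sub_zero]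
    exact single_mem_supported F 1 ⟨h1, h2, by simp⟩
  | cons b l =>
    by_cases hb : b = a
    · subst hb
      rw [← cons_basisChain, uncons_cons_self, sub_self]
      exact zero_mem _
    · rw [← cons_basisChain, uncons_cons_of_ne hb, map_zero, sub_zero, cons_basisChain]
      exact basisChain_mem_headChains h1 h2 hb

theorem boundary_homotopy {U : Finset β} {u : β} (hu : u ∈ U) {p : ℕ} {x : Chains β F}
    (hx : x ∈ headChains F U p (· ≠ {u})) :
    boundary (homotopy u x) + homotopy u (boundary x) = x := by
  refine eq_of_mem_supported (f := boundary ∘ₗ homotopy u + homotopy u ∘ₗ boundary)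
    (g := LinearMap.id) (fun l hl => ?_) hx
  exact boundary_homotopy_basisChain hu hl.1 fun h => hl.2.2 _ h rfl

theorem insert_sdiff_singleton {U : Finset β} {u : β} (hu : u ∉ U) : insert u U \ {u} = U := by
  rw [Finset.sdiff_singleton_eq_erase, Finset.erase_insert hu]

theorem boundary_uncons_singleton {U : Finset β} {p : ℕ} {x : Chains β F} (u : β)
    (hx : x ∈ partitionChains F U p) (h : boundary x = 0) :
    boundary (uncons {u} x) = 0 := by
  have h1 : x ∈ headChains F U p (¬ · ⊂ {u}) :=
    partitionChains_le_headChains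
      (fun b hb => by rw [Finset.ssubset_singleton_iff]; exact hb.ne_empty) hx
  have h2 := uncons_boundary h1
  rwa [h, map_zero, eq_comm, neg_eq_zero] at h2

/-- Below the top degree, cycles of ordered set partitions are boundaries. -/
theorem exists_boundary_eq {U : Finset β} {p : ℕ} (h : p < U.card) {x : Chains β F}
    (hx : x ∈ partitionChains F U p) (h0 : boundary x = 0) :
    ∃ y ∈ partitionChains F U (p + 1), boundary y = x := by
  induction U using Finset.induction generalizing p x with
  | empty => simp at h
  | insert u U hu ih =>
    cases p with
    | zero =>
      rw [partitionChains_zero (by simp), Submodule.mem_bot] at hx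
      exact ⟨0, zero_mem _, by simp [hx]⟩
    | succ p =>
      rw [Finset.card_insert_of_notMem hu] at h
      have h1 := uncons_mem (a := {u}) hx
      rw [insert_sdiff_singleton hu] at h1
      -- The homotopy contracts everything except lists starting with `{u}`. The tails of those in
      -- `x` form a cycle on a smaller set; a primitive `y` of it lets `boundary (cons {u} y)`
      -- remove them from `x`.
      obtain ⟨y, hy, hyx⟩ := ih (by omega) h1 (boundary_uncons_singleton u hx h0)
      have hy' : y ∈ partitionChains F (insert u U \ {u}) (p + 1) := by
        rwa [insert_sdiff_singleton hu]
      have he : x - cons {u} (uncons {u} x) + mergeHead {u} y ∈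
          headChains F (insert u U) (p + 1) (· ≠ {u}) :=
        add_mem (sub_cons_uncons_mem _ hx) (headChains_mono (fun b hb => (ne_of_gt hb))
          (mergeHead_mem_headChains (by simp) (by simp) hy'))
      have hb : x - cons {u} (uncons {u} x) + mergeHead {u} y = x + boundary (cons {u} y) := by
        rw [boundary_cons, hyx]
        abel
      refine ⟨homotopy u (x + boundary (cons {u} y)) - cons {u} y,
        sub_mem (homotopy_mem u ?_) (cons_mem (by simp) (by simp) hy'), ?_⟩
      · rw [← hb]
        exact headChains_le _ _ _ he
      · have h4 := boundary_homotopy (Finset.mem_insert_self u U) he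
        rw [hb, map_add boundary, h0, boundary_boundary, add_zero, map_zero, add_zero] at h4
        rw [map_sub, h4, add_sub_cancel_right]

/-- The chain `homotopy u x` would need more blocks than `U` has elements, so the homotopy identity
reduces to `x = 0`. -/
theorem eq_zero_of_uncons_eq_zero {U : Finset β} {u : β} (hu : u ∈ U) {p : ℕ} {x : Chains β F}
    (hx : x ∈ partitionChains F U p) (hp : U.card ≤ p) (h0 : boundary x = 0)
    (h1 : uncons {u} x = 0) : x = 0 := by
  have he := sub_cons_uncons_mem {u} hx
  rw [h1, map_zero, sub_zero] at he
  have h2 := homotopy_mem u hx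
  rw [partitionChains_eq_bot (by omega), Submodule.mem_bot] at h2
  rw [← boundary_homotopy hu he, h0, h2, map_zero, map_zero, add_zero]

/-- A cycle of ordered set partitions in the top degree is determined by one coefficient. -/
theorem eq_zero_of_boundary_eq_zero {L : List β} (hL : L.Nodup) {x : Chains β F}
    (hx : x ∈ partitionChains F L.toFinset L.length) (h0 : boundary x = 0)
    (h1 : x (L.map singleton) = 0) : x = 0 := by
  induction L generalizing x with
  | nil =>
    ext l
    cases l with
    | nil => exact h1
    | cons a l =>
      by_contra h
      simpa using (hx (mem_support_iff.2 h)).2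
  | cons u L ih =>
    obtain ⟨hu, hL⟩ := List.nodup_cons.1 hL
    rw [List.toFinset_cons] at hx
    refine eq_zero_of_uncons_eq_zero (Finset.mem_insert_self _ _) hx ?_ h0
      (ih hL ?_ (boundary_uncons_singleton u hx h0) ?_)
    · rw [Finset.card_insert_of_notMem (by simpa using hu), List.toFinset_card_of_nodup hL]
      simp
    · have := uncons_mem (a := {u}) hx
      rwa [insert_sdiff_singleton (by simpa using hu)] at this
    · rw [uncons_apply]
      exact h1

end Partitions

section CyclicBoundary

variable {β F : Type*} [Field F]

/-! ### The cyclic boundary -/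

/-- Insert a block in the second place. -/
noncomputable def insertSecond (b : Finset β) : Chains β F →ₗ[F] Chains β F :=
  extend fun
    | [] => 0
    | a :: l => basisChain (a :: b :: l)

@[simp]
theorem insertSecond_nil (b : Finset β) : insertSecond b (basisChain [] : Chains β F) = 0 :=
  extend_basisChain _ _

@[simp]
theorem insertSecond_cons (a b : Finset β) (x : Chains β F) :
    insertSecond b (cons a x) = cons a (cons b x) := by
  refine eq_of_basisChain (f := insertSecond b ∘ₗ cons a) (g := cons a ∘ₗ cons b)
    (fun l => ?_) x
  simp only [LinearMap.comp_apply, cons_basisChain]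
  exact extend_basisChain _ _

/-- The signed sum of all insertions of the block `{u}` after the first block. -/
noncomputable def shuffleTail (u : β) : Chains β F →ₗ[F] Chains β F :=
  extend fun
    | [] => 0
    | a :: l => cons a (shuffle u (basisChain l))

@[simp]
theorem shuffleTail_nil (u : β) : shuffleTail u (basisChain [] : Chains β F) = 0 :=
  extend_basisChain _ _

@[simp]
theorem shuffleTail_cons (u : β) (a : Finset β) (x : Chains β F) :
    shuffleTail u (cons a x) = cons a (shuffle u x) := by
  refine eq_of_basisChain (f := shuffleTail u ∘ₗ cons a) (g := cons a ∘ₗ shuffle u)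
    (fun l => ?_) x
  simp only [LinearMap.comp_apply, cons_basisChain]
  exact extend_basisChain _ _

theorem shuffleTail_insertSecond (u : β) (b : Finset β) (x : Chains β F) :
    shuffleTail u (insertSecond b x) =
      insertSecond {u} (insertSecond b x) - insertSecond b (shuffleTail u x) := by
  refine eq_of_basisChain (f := shuffleTail u ∘ₗ insertSecond b)
    (g := insertSecond {u} ∘ₗ insertSecond b - insertSecond b ∘ₗ shuffleTail u)
    (fun l => ?_) x
  simp only [LinearMap.comp_apply, LinearMap.sub_apply]
  cases l with
  | nil => simp
  | cons a l => rw [← cons_basisChain]; simp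

variable [DecidableEq β]

/-- The signed list obtained from `a :: l` by uniting the last block of `l` with `a`. -/
noncomputable def wrapHeadList (a : Finset β) : List (Finset β) → Chains β F
  | [] => 0
  | [b] => -basisChain [a ∪ b]
  -- The recursive value already starts with the union of `a` and the last block, so `b` belongs in
  -- second place.
  | b :: c :: l => -insertSecond b (wrapHeadList a (c :: l))

/-- The linear extension of `wrapHeadList`. -/
noncomputable def wrapHead (a : Finset β) : Chains β F →ₗ[F] Chains β F := extend (wrapHeadList a)

@[simp]
theorem wrapHead_nil (a : Finset β) : wrapHead a (basisChain [] : Chains β F) = 0 :=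
  extend_basisChain _ _

@[simp]
theorem wrapHead_cons_nil (a b : Finset β) :
    wrapHead a (cons b (basisChain [] : Chains β F)) = -cons (a ∪ b) (basisChain []) := by
  rw [cons_basisChain, cons_basisChain]
  exact extend_basisChain _ _

@[simp]
theorem wrapHead_cons_cons (a b c : Finset β) (x : Chains β F) :
    wrapHead a (cons b (cons c x)) = -insertSecond b (wrapHead a (cons c x)) := by
  refine eq_of_basisChain (f := wrapHead a ∘ₗ cons b ∘ₗ cons c)
    (g := -(insertSecond b ∘ₗ wrapHead a ∘ₗ cons c : Chains β F →ₗ[F] Chains β F))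
    (fun l => ?_) x
  simp only [LinearMap.comp_apply, LinearMap.neg_apply, cons_basisChain, wrapHead,
    extend_basisChain, wrapHeadList]

/-- Unite the last block with the first block, with a sign. -/
noncomputable def wrap : Chains β F →ₗ[F] Chains β F :=
  extend fun
    | [] => 0
    | a :: l => wrapHead a (basisChain l)

@[simp]
theorem wrap_nil : wrap (basisChain [] : Chains β F) = 0 :=
  extend_basisChain _ _

@[simp]
theorem wrap_cons (a : Finset β) (x : Chains β F) : wrap (cons a x) = wrapHead a x := by
  refine eq_of_basisChain (f := wrap ∘ₗ cons a) (g := wrapHead a) (fun l => ?_) x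
  simp only [LinearMap.comp_apply, cons_basisChain]
  exact extend_basisChain _ _

/-- The signed sum of all unions of two cyclically adjacent blocks. -/
noncomputable def torusBoundary : Chains β F →ₗ[F] Chains β F := boundary + wrap

theorem torusBoundary_cons (a : Finset β) (x : Chains β F) :
    torusBoundary (cons a x) = mergeHead a x - cons a (boundary x) + wrapHead a x := by
  simp [torusBoundary]

/-- The right side is the insertion of `{u}` at the very end, where `{u}` itself is wrapped into
`a`. For all other insertions the two operations anticommute. -/
theorem wrapHead_shuffle (a : Finset β) (u : β) (x : Chains β F) :
    wrapHead a (shuffle u x) + shuffleTail u (wrapHead a x) = -cons (a ∪ {u}) x := by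
  refine eq_of_basisChain (f := wrapHead a ∘ₗ shuffle u + shuffleTail u ∘ₗ wrapHead a)
    (g := -(cons (a ∪ {u}) : Chains β F →ₗ[F] Chains β F)) (fun l => ?_) x
  simp only [LinearMap.comp_apply, LinearMap.add_apply, LinearMap.neg_apply]
  induction l with
  | nil => simp
  | cons b t ih =>
    rw [← cons_basisChain]
    cases t with
    | nil =>
      simp only [shuffle_cons, shuffle_nil, map_sub, wrapHead_cons_cons, wrapHead_cons_nil,
        map_neg, insertSecond_cons, shuffleTail_cons]
      abel
    | cons c t =>
      rw [← cons_basisChain] at ih ⊢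
      have := congrArg (insertSecond b) ih
      simp only [shuffle_cons, wrapHead_cons_cons, map_sub, map_neg, insertSecond_cons, map_add,
        shuffleTail_insertSecond] at this ⊢
      rw [← this]
      abel

/-- As in `boundary_shuffle`, now cyclically: inserting `{u}` right after the first block `a` and
inserting it at the end both lead to `a ∪ {u}`, with opposite signs. -/
theorem torusBoundary_shuffleTail (u : β) (x : Chains β F) :
    torusBoundary (shuffleTail u x) = -shuffleTail u (torusBoundary x) := by
  refine eq_of_basisChain (f := torusBoundary ∘ₗ shuffleTail u)
    (g := -(shuffleTail u ∘ₗ torusBoundary : Chains β F →ₗ[F] Chains β F)) (fun l => ?_) x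
  simp only [LinearMap.comp_apply, LinearMap.neg_apply]
  cases l with
  | nil => simp [torusBoundary]
  | cons a l =>
    have h := wrapHead_shuffle a u (basisChain l : Chains β F)
    rw [← eq_sub_iff_add_eq] at h
    rw [← cons_basisChain, shuffleTail_cons, torusBoundary_cons, torusBoundary_cons, h,
      boundary_shuffle, map_add, map_sub, shuffleTail_cons]
    cases l with
    | nil => simp
    | cons b t =>
      rw [← cons_basisChain]
      simp only [shuffle_cons, map_sub, mergeHead_cons, shuffleTail_cons, map_neg]
      abel

/-! ### Fundamental cycles -/

/-- The signed sum of all orderings of a list of vertices. -/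
noncomputable def orderings : List β → Chains β F
  | [] => basisChain []
  | u :: L => shuffle u (orderings L)

theorem orderings_mem {L : List β} (hL : L.Nodup) :
    (orderings L : Chains β F) ∈ partitionChains F L.toFinset L.length := by
  induction L with
  | nil => exact basisChain_mem rfl rfl
  | cons u L ih =>
    obtain ⟨hu, hL⟩ := List.nodup_cons.1 hL
    rw [List.toFinset_cons]
    exact shuffle_mem (by simpa using hu) (ih hL)

theorem torusBoundary_cons_orderings (a : Finset β) (L : List β) :
    torusBoundary (cons a (orderings L : Chains β F)) = 0 := by
  induction L with
  | nil => simp [orderings, torusBoundary_cons]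
  | cons u L ih => rw [orderings, ← shuffleTail_cons, torusBoundary_shuffleTail, ih]; simp

/-! ### Cocycles -/

/-- The coefficient functional of the lists whose traces on `U` are the singletons of the
entries of `L`. -/
noncomputable def tailCocycle (U : Finset β) (L : List β) : Chains β F →ₗ[F] F :=
  linearCombination F fun l => if l.map (· ∩ U) = L.map singleton then 1 else 0

/-- The coefficient functional of the lists whose first block is disjoint from `U`
while the traces on `U` of the other blocks are the singletons of the entries of `L`. -/
noncomputable def torusCocycle (U : Finset β) (L : List β) : Chains β F →ₗ[F] F :=
  linearCombination F fun
    | [] => 0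
    | a :: l => if a ∩ U = ∅ then tailCocycle U L (basisChain l) else 0

theorem tailCocycle_basisChain (U : Finset β) (L : List β) (l : List (Finset β)) :
    tailCocycle U L (basisChain l : Chains β F) =
      if l.map (· ∩ U) = L.map singleton then 1 else 0 := by
  simp [tailCocycle]

theorem torusCocycle_nil (U : Finset β) (L : List β) :
    torusCocycle U L (basisChain [] : Chains β F) = 0 := by
  simp [torusCocycle]

theorem torusCocycle_cons (U : Finset β) (L : List β) (a : Finset β) (x : Chains β F) :
    torusCocycle U L (cons a x) = if a ∩ U = ∅ then tailCocycle U L x else 0 := by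
  split_ifs with h
  · refine eq_of_basisChain (f := torusCocycle U L ∘ₗ cons a) (fun l => ?_) x
    simp [torusCocycle, cons_basisChain, h]
  · refine eq_of_basisChain (f := torusCocycle U L ∘ₗ cons a) (g := 0) (fun l => ?_) x
    simp [torusCocycle, cons_basisChain, h]

@[simp]
theorem tailCocycle_nil_cons (U : Finset β) (a : Finset β) (x : Chains β F) :
    tailCocycle U [] (cons a x) = 0 := by
  refine eq_of_basisChain (f := tailCocycle U [] ∘ₗ cons a) (g := 0) (fun l => ?_) x
  simp [tailCocycle, cons_basisChain]

theorem tailCocycle_cons_cons (U : Finset β) (u : β) (L : List β) (a : Finset β)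
    (x : Chains β F) :
    tailCocycle U (u :: L) (cons a x) = if a ∩ U = {u} then tailCocycle U L x else 0 := by
  split_ifs with h
  · refine eq_of_basisChain (f := tailCocycle U (u :: L) ∘ₗ cons a) (fun l => ?_) x
    simp [tailCocycle, cons_basisChain, h]
  · refine eq_of_basisChain (f := tailCocycle U (u :: L) ∘ₗ cons a) (g := 0) (fun l => ?_) x
    simp [tailCocycle, cons_basisChain, h]

theorem torusCocycle_nil_insertSecond (U b : Finset β) (x : Chains β F) :
    torusCocycle U [] (insertSecond b x) = 0 := by
  refine eq_of_basisChain (f := torusCocycle U [] ∘ₗ insertSecond b) (g := 0) (fun l => ?_) x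
  simp only [LinearMap.comp_apply, LinearMap.zero_apply]
  cases l with
  | nil => simp
  | cons a l => rw [← cons_basisChain]; simp [torusCocycle_cons]

theorem torusCocycle_cons_insertSecond (U b : Finset β) (u : β) (L : List β) (x : Chains β F) :
    torusCocycle U (u :: L) (insertSecond b x) =
      if b ∩ U = {u} then torusCocycle U L x else 0 := by
  split_ifs with h
  · refine eq_of_basisChain (f := torusCocycle U (u :: L) ∘ₗ insertSecond b) (fun l => ?_) x
    simp only [LinearMap.comp_apply]
    cases l with
    | nil => simp [torusCocycle_nil]
    | cons a l =>
      rw [← cons_basisChain]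
      simp [torusCocycle_cons, tailCocycle_cons_cons, h]
  · refine eq_of_basisChain (f := torusCocycle U (u :: L) ∘ₗ insertSecond b) (g := 0)
      (fun l => ?_) x
    simp only [LinearMap.comp_apply]
    cases l with
    | nil => simp
    | cons a l =>
      rw [← cons_basisChain]
      simp [torusCocycle_cons, tailCocycle_cons_cons, h]

/-- Applied to the traces on `U` of two adjacent blocks: a union has trace `{u}` only if one of the
two traces is empty. -/
theorem union_eq_singleton_ite {M : Type*} [AddMonoid M] {s t : Finset β} (h : Disjoint s t)
    (u : β) (c : M) :
    (if s ∪ t = {u} then c else 0) =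
      (if s = ∅ then if t = {u} then c else 0 else 0) +
        if s = {u} then if t = ∅ then c else 0 else 0 := by
  by_cases hs : s = ∅
  · subst hs
    simp [(Finset.singleton_ne_empty u).symm]
  · by_cases hs' : s = {u}
    · subst hs'
      rw [Finset.disjoint_singleton_left] at h
      by_cases ht : t = ∅
      · simp [ht]
      · have : ¬ ({u} ∪ t = {u}) := fun h' => ht <| by
          rw [Finset.union_eq_left, Finset.subset_singleton_iff] at h'
          rcases h' with h' | h'
          · exact h'
          · simp [h'] at h
        rw [if_neg this]
        simp [ht]
    · have : ¬ (s ∪ t = {u}) := fun h' => by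
        have := Finset.subset_singleton_iff.1 (h' ▸ Finset.subset_union_left : s ⊆ {u})
        tauto
      simp [this, hs, hs']

/-- Only lists with exactly one block of empty trace contribute. An interior such block can be
absorbed by its left or its right neighbour, and these terms cancel. At either end one neighbour is
missing, which leaves the two terms on the right. -/
theorem tailCocycle_boundary (U : Finset β) (L : List β) {a b V : Finset β} (ha : a ∩ U = ∅)
    {t : List (Finset β)} (h : IsPartition V (b :: t)) :
    tailCocycle U L (boundary (basisChain (b :: t) : Chains β F)) =
      (if b ∩ U = ∅ then tailCocycle U L (basisChain t : Chains β F) else 0) +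
        torusCocycle U L (wrapHead a (basisChain (b :: t) : Chains β F)) := by
  induction t generalizing b V L with
  | nil =>
    rw [← cons_basisChain]
    simp [torusCocycle_cons, Finset.union_inter_distrib_right, ha]
  | cons c t ih =>
    have h2 := h.2.2
    have hbc : Disjoint (b ∩ U) (c ∩ U) :=
      (Finset.disjoint_sdiff.mono_right h2.2.1).mono Finset.inter_subset_left
        Finset.inter_subset_left
    cases L with
    | nil =>
      rw [← cons_basisChain, ← cons_basisChain]
      simp [torusCocycle_nil_insertSecond]
    | cons u L =>
      have ih := ih (L := L) h2
      rw [← cons_basisChain] at ih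
      rw [← cons_basisChain, ← cons_basisChain]
      rw [wrapHead_cons_cons, boundary_cons, map_sub, mergeHead_cons, tailCocycle_cons_cons,
        tailCocycle_cons_cons, tailCocycle_cons_cons, ih, map_neg,
        torusCocycle_cons_insertSecond, Finset.union_inter_distrib_right,
        union_eq_singleton_ite hbc]
      by_cases hb : b ∩ U = {u}
      · simp [hb]
      · simp [hb]

theorem torusCocycle_wrapHead_of_ne (U : Finset β) (L : List β) {a : Finset β}
    (ha : a ∩ U ≠ ∅) (x : Chains β F) : torusCocycle U L (wrapHead a x) = 0 := by
  refine eq_of_basisChain (f := torusCocycle U L ∘ₗ wrapHead a) (g := 0) (fun l => ?_) x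
  simp only [LinearMap.comp_apply, LinearMap.zero_apply]
  induction l generalizing L with
  | nil => simp
  | cons b t ih =>
    rw [← cons_basisChain]
    cases t with
    | nil => simp [torusCocycle_cons, Finset.union_inter_distrib_right, ha]
    | cons c t =>
      rw [← cons_basisChain] at ih ⊢
      cases L with
      | nil => simp [torusCocycle_nil_insertSecond]
      | cons u L => simp [torusCocycle_cons_insertSecond, ih]

/-- The two end terms of `tailCocycle_boundary` are the unions of the first block with its two
cyclic neighbours. If the first block meets `U`, so does the first block of every term. -/
theorem torusCocycle_torusBoundary (U : Finset β) (L : List β) {V : Finset β} {p : ℕ}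
    {x : Chains β F} (hx : x ∈ partitionChains F V p) :
    torusCocycle U L (torusBoundary x) = 0 := by
  refine eq_of_mem_supported (f := torusCocycle U L ∘ₗ torusBoundary) (g := 0)
    (fun l hl => ?_) hx
  simp only [LinearMap.comp_apply, LinearMap.zero_apply]
  cases l with
  | nil => simp [torusBoundary]
  | cons a l =>
    rw [← cons_basisChain, torusBoundary_cons, map_add, map_sub, torusCocycle_cons]
    cases l with
    | nil => simp
    | cons b t =>
      by_cases ha : a ∩ U = ∅
      · rw [if_pos ha, tailCocycle_boundary U L ha hl.1.2.2, ← cons_basisChain, mergeHead_cons,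
          torusCocycle_cons, Finset.union_inter_distrib_right, ha, Finset.empty_union]
        abel
      · rw [torusCocycle_wrapHead_of_ne U L ha, if_neg ha, ← cons_basisChain, mergeHead_cons,
          torusCocycle_cons, Finset.union_inter_distrib_right]
        simp [ha]

/-- Only the ordering `L` itself is counted: among the insertions of `{u}`, just the one at the
front puts `u` into the first block. -/
theorem tailCocycle_orderings {U : Finset β} {L : List β} (hL : L.Nodup) (hU : L.toFinset ⊆ U) :
    tailCocycle U L (orderings L : Chains β F) = 1 := by
  induction L with
  | nil => simp [orderings, tailCocycle]
  | cons u L ih =>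
    obtain ⟨hu, hL'⟩ := List.nodup_cons.1 hL
    rw [List.toFinset_cons, Finset.insert_subset_iff] at hU
    rw [← ih hL' hU.2, orderings]
    refine eq_of_mem_supported (M := F) (f := (tailCocycle U (u :: L) : Chains β F →ₗ[F] F) ∘ₗ
      shuffle u) (g := tailCocycle U L) (fun l hl => ?_) (orderings_mem hL')
    simp only [LinearMap.comp_apply]
    cases l with
    | nil => simp [tailCocycle_cons_cons, hU.1]
    | cons b t =>
      have hb : b ∩ U ≠ {u} := fun h => by
        have : u ∈ b ∩ U := h ▸ Finset.mem_singleton_self u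
        exact hu (List.mem_toFinset.1 (hl.1.2.1 (Finset.mem_inter.1 this).1))
      rw [← cons_basisChain, shuffle_cons, map_sub, tailCocycle_cons_cons,
        tailCocycle_cons_cons, if_neg hb]
      simp [hU.1]

end CyclicBoundary

/-! ### Lists of fibres -/

section FiberList

variable {β : Type*} [Fintype β]

/-- The list of the fibres of a map to `Fin m`. -/
def fiberList {m : ℕ} (g : β → Fin m) : List (Finset β) :=
  List.ofFn fun i => Finset.univ.filter (g · = i)

theorem fiberList_injective (m : ℕ) :
    Function.Injective (fiberList : (β → Fin m) → List (Finset β)) := by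
  intro g h hgh
  have := List.ofFn_injective hgh
  ext v : 1
  have hv : v ∈ Finset.univ.filter (g · = g v) := by simp
  have h1 := congrFun this (g v)
  rw [h1] at hv
  exact (Finset.mem_filter.1 hv).2.symm

end FiberList

/-! ### Unions of adjacent blocks as reindexings of fibres -/

section Fibers

variable {β F : Type*} [Field F] [DecidableEq β]

/-- Unite the consecutive members `i` and `i + 1` of a family of blocks. -/
def mergeFamily {m : ℕ} (i : Fin (m + 1)) (c : Fin (m + 2) → Finset β) (j : Fin (m + 1)) :
    Finset β :=
  if j < i then c j.castSucc else if j = i then c j.castSucc ∪ c j.succ else c j.succ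

theorem boundary_ofFn {m : ℕ} (c : Fin (m + 2) → Finset β) :
    boundary (basisChain (List.ofFn c) : Chains β F) =
      ∑ i : Fin (m + 1), (-1 : F) ^ (i : ℕ) • basisChain (List.ofFn (mergeFamily i c)) := by
  induction m with
  | zero =>
    simp only [List.ofFn_succ, List.ofFn_zero, ← cons_basisChain]
    simp [mergeFamily]
  | succ m ih =>
    rw [Fin.sum_univ_succ, List.ofFn_succ, ← cons_basisChain, boundary_cons,
      ih (fun i => c i.succ), sub_eq_add_neg, map_sum, ← Finset.sum_neg_distrib]
    congr 1
    · have h : (fun i : Fin (m + 1) => mergeFamily 0 c i.succ) = fun i => c i.succ.succ := by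
        ext1 i
        simp [mergeFamily, Fin.succ_ne_zero]
      rw [List.ofFn_succ (f := fun i => c i.succ), ← cons_basisChain, mergeHead_cons,
        List.ofFn_succ (f := mergeFamily 0 c), ← cons_basisChain, Fin.val_zero, pow_zero,
        one_smul, h]
      rfl
    · refine Finset.sum_congr rfl fun i _ => ?_
      rw [map_smul, cons_basisChain, Fin.val_succ, pow_succ, mul_neg_one, neg_smul,
        List.ofFn_succ (f := mergeFamily i.succ c)]
      congr 4
      ext1 j
      simp [mergeFamily]

theorem wrapHead_ofFn {m : ℕ} (a : Finset β) (c : Fin (m + 1) → Finset β) :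
    wrapHead a (basisChain (List.ofFn c) : Chains β F) =
      (-1 : F) ^ (m + 1) •
        basisChain ((a ∪ c (Fin.last m)) :: List.ofFn fun i : Fin m => c i.castSucc) := by
  induction m with
  | zero =>
    simp only [List.ofFn_succ, List.ofFn_zero, ← cons_basisChain]
    simp
  | succ m ih =>
    have ih := ih (fun i => c i.succ)
    rw [List.ofFn_succ, ← cons_basisChain] at ih
    rw [List.ofFn_succ, List.ofFn_succ, ← cons_basisChain, ← cons_basisChain,
      wrapHead_cons_cons, ih, map_smul, ← cons_basisChain, insertSecond_cons, pow_succ _ (m + 1),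
      mul_neg_one, neg_smul, cons_basisChain, cons_basisChain, List.ofFn_succ]
    rfl

theorem isPartition_iff {U : Finset β} {l : List (Finset β)} :
    IsPartition U l ↔ (∀ b ∈ l, b.Nonempty) ∧ l.Pairwise Disjoint ∧
      ∀ v, v ∈ U ↔ ∃ b ∈ l, v ∈ b := by
  induction l generalizing U with
  | nil => simp [IsPartition, Finset.eq_empty_iff_forall_notMem]
  | cons a l ih =>
    simp only [IsPartition, ih, List.mem_cons, forall_eq_or_imp, List.pairwise_cons,
      Finset.mem_sdiff, exists_eq_or_imp]
    constructor
    · rintro ⟨h1, h2, h3, h4, h5⟩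
      refine ⟨⟨h1, h3⟩, ⟨fun b hb => ?_, h4⟩, fun v => ?_⟩
      · exact Finset.disjoint_right.2 fun v hv => ((h5 v).2 ⟨b, hb, hv⟩).2
      · rw [← h5]
        have := @h2 v
        tauto
    · rintro ⟨⟨h1, h3⟩, ⟨h2, h4⟩, h5⟩
      refine ⟨h1, fun v hv => (h5 v).2 (Or.inl hv), h3, h4, fun v => ?_⟩
      rw [h5]
      constructor
      · tauto
      · rintro ⟨b, hb, hv⟩
        exact ⟨Or.inr ⟨b, hb, hv⟩, Finset.disjoint_right.1 (h2 b hb) hv⟩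

variable [Fintype β]

-- Links the recursive signs on lists with the explicit boundary formula of the cyclic complex; the
-- last summand is `wrap`.
open Hypergraph in
theorem torusBoundary_fiberList {m : ℕ} (g : β → Fin (m + 2)) :
    torusBoundary (basisChain (fiberList g) : Chains β F) =
      ∑ i : Fin (m + 2), (-1 : F) ^ (i : ℕ) • basisChain (fiberList (mergeIndex i ∘ g)) := by
  rw [Fin.sum_univ_castSucc, torusBoundary, LinearMap.add_apply, fiberList, boundary_ofFn]
  congr 1
  · refine Finset.sum_congr rfl fun i _ => ?_
    rw [fiberList]
    congr 3
    ext j v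
    simp only [mergeFamily, Function.comp_apply, Finset.mem_filter, Finset.mem_univ, true_and,
      mergeIndex, Fin.ext_iff, Fin.val_castSucc]
    have := (g v).2
    have := j.2
    have := i.2
    split_ifs <;> simp <;> omega
  · rw [List.ofFn_succ, ← cons_basisChain, wrap_cons, wrapHead_ofFn, fiberList, List.ofFn_succ]
    congr 3
    · ext v
      simp only [Function.comp_apply, Finset.mem_filter, Finset.mem_univ, true_and, mergeIndex,
        Fin.ext_iff, Finset.mem_union, Fin.val_zero, Fin.val_last, Fin.val_succ]
      have := (g v).2
      split_ifs <;> omega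
    · congr 1
      ext j v
      simp only [Function.comp_apply, Finset.mem_filter, Finset.mem_univ, true_and, mergeIndex,
        Fin.ext_iff, Fin.val_last, Fin.val_succ, Fin.val_castSucc]
      have := (g v).2
      have := j.2
      split_ifs <;> (try rw [iff_false]) <;> omega

theorem isPartition_fiberList {m : ℕ} {g : β → Fin m} (hg : Function.Surjective g) :
    IsPartition Finset.univ (fiberList g) := by
  rw [isPartition_iff, fiberList]
  refine ⟨?_, ?_, ?_⟩
  · intro b hb
    obtain ⟨i, rfl⟩ := List.mem_ofFn.1 hb
    obtain ⟨v, hv⟩ := hg i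
    exact ⟨v, by simp [hv]⟩
  · rw [List.pairwise_ofFn]
    intro i j hij
    rw [Finset.disjoint_left]
    intro v hv hv'
    simp only [Finset.mem_filter, Finset.mem_univ, true_and] at hv hv'
    exact hij.ne (hv.symm.trans hv')
  · intro v
    simp [List.mem_ofFn]

theorem exists_fiberList_eq {l : List (Finset β)} (hl : IsPartition Finset.univ l) {m : ℕ}
    (hm : l.length = m) : ∃ g : β → Fin m, Function.Surjective g ∧ fiberList g = l := by
  subst hm
  obtain ⟨h1, h2, h3⟩ := isPartition_iff.1 hl
  have h4 : ∀ v, ∃ i : Fin l.length, v ∈ l[i] := fun v => by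
    obtain ⟨b, hb, hv⟩ := (h3 v).1 (Finset.mem_univ v)
    obtain ⟨i, hi, rfl⟩ := List.mem_iff_getElem.1 hb
    exact ⟨⟨i, hi⟩, hv⟩
  choose g hg using h4
  have h5 : ∀ v (i : Fin l.length), v ∈ l[i] → g v = i := fun v i hi => by
    by_contra h
    rw [List.pairwise_iff_getElem] at h2
    rcases lt_or_gt_of_ne h with h | h
    · exact Finset.disjoint_left.1 (h2 _ _ (g v).2 i.2 h) (hg v) hi
    · exact Finset.disjoint_left.1 (h2 _ _ i.2 (g v).2 h) hi (hg v)
  refine ⟨g, fun i => ?_, ?_⟩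
  · obtain ⟨v, hv⟩ := h1 l[i] (List.getElem_mem _)
    exact ⟨v, h5 v i hv⟩
  · refine List.ext_getElem (by simp [fiberList]) fun i h h' => ?_
    ext v
    simp only [fiberList, List.getElem_ofFn, Finset.mem_filter, Finset.mem_univ, true_and]
    exact ⟨fun h => by have := hg v; rwa [h] at this, fun h => h5 v ⟨i, h'⟩ h⟩

open Hypergraph in
theorem mergeIndex_comp_mergeIndex {m : ℕ} {i : Fin (m + 3)} {j : Fin (m + 2)}
    (h : (i : ℕ) ≤ j) :
    mergeIndex j ∘ mergeIndex i = mergeIndex (i.castLT (by omega)) ∘ mergeIndex j.succ := by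
  ext t
  have := t.2
  have := j.2
  simp only [Function.comp_apply, mergeIndex, Fin.val_castLT, Fin.val_succ]
  split_ifs <;> omega

-- The pairs `(i, j)` with `i ≤ j` are matched with `(j + 1, i)`: the composites agree and the signs
-- are opposite.
open Hypergraph in
theorem sum_mergeIndex_mergeIndex {M : Type*} [AddCommGroup M] [Module F M] {m : ℕ}
    (f : (Fin (m + 3) → Fin (m + 1)) → M) :
    ∑ i : Fin (m + 3), (-1 : F) ^ (i : ℕ) • ∑ j : Fin (m + 2), (-1 : F) ^ (j : ℕ) •
      f (mergeIndex j ∘ mergeIndex i) = 0 := by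
  simp only [Finset.smul_sum, smul_smul, ← pow_add]
  rw [← Finset.sum_product', ← Finset.sum_filter_add_sum_filter_not _
    (fun p : Fin (m + 3) × Fin (m + 2) => (p.1 : ℕ) ≤ p.2), ← eq_neg_iff_add_eq_zero,
    ← Finset.sum_neg_distrib]
  refine Finset.sum_bij' (fun p hp => (p.2.succ, p.1.castLT (by
      have := (Finset.mem_filter.1 hp).2; omega)))
    (fun p hp => (p.2.castSucc, p.1.pred (by
      have := (Finset.mem_filter.1 hp).2; rintro h; simp [h] at this))) ?_ ?_ ?_ ?_ ?_
  · intro p hp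
    have := (Finset.mem_filter.1 hp).2
    simp only [Finset.mem_filter, Finset.mem_product, Finset.mem_univ, true_and, Fin.val_succ,
      Fin.val_castLT]
    omega
  · intro p hp
    have := (Finset.mem_filter.1 hp).2
    simp only [Finset.mem_filter, Finset.mem_product, Finset.mem_univ, true_and, Fin.val_pred,
      Fin.val_castSucc]
    omega
  · intro p hp
    simp
  · intro p hp
    simp
  · intro p hp
    have := (Finset.mem_filter.1 hp).2
    rw [mergeIndex_comp_mergeIndex this, Fin.val_succ, Fin.val_castLT, ← neg_smul]
    congr 1
    ring

theorem torusBoundary_torusBoundary_fiberList {m : ℕ} (g : β → Fin (m + 3)) :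
    torusBoundary (torusBoundary (basisChain (fiberList g) : Chains β F)) = 0 := by
  simp only [torusBoundary_fiberList, map_sum, map_smul]
  exact sum_mergeIndex_mergeIndex fun t => basisChain (fiberList (t ∘ g))

theorem torusBoundary_torusBoundary_of_three_le {p : ℕ} {x : Chains β F}
    (hx : x ∈ partitionChains F Finset.univ (p + 3)) : torusBoundary (torusBoundary x) = 0 := by
  refine eq_of_mem_supported (f := torusBoundary ∘ₗ torusBoundary) (g := 0)
    (fun l hl => ?_) hx
  obtain ⟨g, -, rfl⟩ := exists_fiberList_eq hl.1 hl.2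
  exact torusBoundary_torusBoundary_fiberList g

end Fibers

section Exactness

/-! ### Cycles on which all cocycles vanish are boundaries -/

variable {β F : Type*} [Field F] [DecidableEq β]

theorem insertSecond_mem_headChains {U b : Finset β} (hb : b.Nonempty) (hbU : b ⊆ U) {p : ℕ}
    {P : Finset β → Prop} {x : Chains β F} (hx : x ∈ headChains F (U \ b) p P) :
    insertSecond b x ∈ headChains F U (p + 1) P := by
  refine map_mem_of_mem_supported (fun l hl => ?_) hx
  obtain ⟨h1, h2, h3⟩ := hl
  cases l with
  | nil => simp
  | cons a l =>
    obtain ⟨h4, h5, h6⟩ := h1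
    rw [← cons_basisChain, insertSecond_cons, cons_basisChain, cons_basisChain]
    refine basisChain_mem_headChains ⟨h4, h5.trans Finset.sdiff_subset, hb, ?_, ?_⟩
      (by simpa using h2) (h3 a (by simp))
    · exact Finset.subset_sdiff.2 ⟨hbU, (Finset.subset_sdiff.1 h5).2.symm⟩
    · rwa [sdiff_right_comm]

theorem wrapHead_basisChain_mem {U a : Finset β} (ha : a.Nonempty) (haU : a ⊆ U)
    {l : List (Finset β)} (hl : IsPartition (U \ a) l) :
    wrapHead a (basisChain l : Chains β F) ∈ headChains F U l.length (a ⊂ ·) := by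
  induction l generalizing U with
  | nil => simp
  | cons b t ih =>
    obtain ⟨h1, h2, h3⟩ := hl
    cases t with
    | nil =>
      rw [← cons_basisChain, wrapHead_cons_nil, cons_basisChain]
      exact neg_mem (basisChain_mem_headChains
        (IsPartition.merge ⟨ha, haU, h1, h2, h3⟩) rfl (ssubset_union h1 h2))
    | cons c t =>
      rw [← cons_basisChain, ← cons_basisChain, wrapHead_cons_cons, cons_basisChain]
      obtain ⟨h4, h5⟩ := Finset.subset_sdiff.1 h2
      refine neg_mem (insertSecond_mem_headChains h1 h4
        (ih (Finset.subset_sdiff.2 ⟨haU, h5.symm⟩) ?_))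
      rwa [sdiff_right_comm]

theorem wrapHead_mem_headChains {U a : Finset β} {p : ℕ} (ha : a.Nonempty) (haU : a ⊆ U)
    {x : Chains β F} (hx : x ∈ partitionChains F (U \ a) p) :
    wrapHead a x ∈ headChains F U p (a ⊂ ·) := by
  refine map_mem_of_mem_supported (fun l hl => ?_) hx
  rw [← hl.2]
  exact wrapHead_basisChain_mem ha haU hl.1

theorem torusBoundary_mem {U : Finset β} {p : ℕ} {x : Chains β F}
    (hx : x ∈ partitionChains F U (p + 1)) : torusBoundary x ∈ partitionChains F U p := by
  refine add_mem (boundary_mem hx) (map_mem_of_mem_supported (fun l hl => ?_) hx)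
  cases l with
  | nil => simp
  | cons a l =>
    obtain ⟨⟨h1, h2, h3⟩, h4⟩ := hl
    rw [← cons_basisChain, wrap_cons]
    exact headChains_le _ _ _ (wrapHead_mem_headChains h1 h2
      (basisChain_mem h3 (by simpa using h4)))

/-- The cyclic union also strictly enlarges the first block, so it is invisible on the layer with
first block `a`. -/
theorem uncons_torusBoundary {U a : Finset β} {p : ℕ} {x : Chains β F}
    (hx : x ∈ headChains F U p (¬ · ⊂ a)) :
    uncons a (torusBoundary x) = -boundary (uncons a x) := by
  rw [torusBoundary, LinearMap.add_apply, map_add, uncons_boundary hx, add_eq_left]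
  refine eq_of_mem_supported (f := uncons a ∘ₗ wrap) (g := 0) (fun l hl => ?_) hx
  obtain ⟨h1, -, h3⟩ := hl
  simp only [LinearMap.comp_apply]
  cases l with
  | nil => simp
  | cons b l =>
    have hb : ¬ b ⊂ a := h3 b (by simp)
    rw [← cons_basisChain, wrap_cons]
    exact uncons_eq_zero hb (wrapHead_mem_headChains h1.1 h1.2.1 (basisChain_mem h1.2.2 rfl))

theorem torusBoundary_eq_zero_of_length_one {U : Finset β} {x : Chains β F}
    (hx : x ∈ partitionChains F U 1) : torusBoundary x = 0 := by
  refine eq_of_mem_supported (f := torusBoundary) (g := 0) (fun l hl => ?_) hx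
  obtain ⟨a, rfl⟩ := List.length_eq_one_iff.1 hl.2
  rw [← cons_basisChain, torusBoundary_cons]
  simp

variable [Fintype β]

theorem sub_sum_cons_uncons_mem {p j : ℕ} {x : Chains β F}
    (hx : x ∈ headChains F Finset.univ p (j ≤ Finset.card ·)) :
    x - ∑ A ∈ Finset.univ.powersetCard j, cons A (uncons A x) ∈
      headChains F Finset.univ p (j + 1 ≤ Finset.card ·) := by
  refine map_mem_of_mem_supported (f := LinearMap.id -
    ∑ A ∈ Finset.univ.powersetCard j, cons A ∘ₗ uncons A) (fun l hl => ?_) hx |> fun h => by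
      simpa using h
  obtain ⟨h1, h2, h3⟩ := hl
  simp only [LinearMap.sub_apply, LinearMap.id_apply, LinearMap.sum_apply, LinearMap.comp_apply]
  cases l with
  | nil =>
    simp only [uncons_nil, map_zero, Finset.sum_const_zero, sub_zero]
    exact single_mem_supported F 1 ⟨h1, h2, by simp⟩
  | cons b l =>
    rw [← cons_basisChain]
    by_cases hb : b.card = j
    · rw [Finset.sum_eq_single_of_mem b (by simp [hb])
        (fun A _ hA => by rw [uncons_cons_of_ne hA.symm, map_zero]), uncons_cons_self, sub_self]
      exact zero_mem _
    · rw [Finset.sum_eq_zero, sub_zero, cons_basisChain]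
      · refine basisChain_mem_headChains h1 h2 ?_
        have := h3 b (by simp)
        omega
      · intro A hA
        rw [Finset.mem_powersetCard_univ] at hA
        rw [uncons_cons_of_ne (by rintro rfl; exact hb hA), map_zero]

/-- A first block disjoint from `U` with at least `Uᶜ.card` elements equals `Uᶜ`. The other blocks
then lie in `U` and are their own traces. -/
theorem torusCocycle_eq_uncons_apply {p : ℕ} (U : Finset β) (L : List β) {x : Chains β F}
    (hx : x ∈ headChains F Finset.univ p (Uᶜ.card ≤ Finset.card ·)) :
    torusCocycle U L x = uncons Uᶜ x (L.map singleton) := by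
  refine eq_of_mem_supported (f := torusCocycle U L)
    (g := lapply (L.map singleton) ∘ₗ uncons Uᶜ) (fun l hl => ?_) hx
  obtain ⟨h1, h2, h3⟩ := hl
  rw [LinearMap.comp_apply]
  cases l with
  | nil => simp [torusCocycle_nil]
  | cons b t =>
    rw [← cons_basisChain, torusCocycle_cons]
    by_cases hb : b = Uᶜ
    · rw [hb, uncons_cons_self,
        if_pos (Finset.disjoint_iff_inter_eq_empty.1 disjoint_compl_left), tailCocycle_basisChain]
      have ht : t.map (· ∩ U) = t := by
        conv_rhs => rw [← List.map_id t]
        refine List.map_congr_left fun c hc => ?_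
        have hcU := (isPartition_iff.1 h1).2.1
        rw [List.pairwise_cons, hb] at hcU
        rw [id, Finset.inter_eq_left]
        exact fun v hv => by_contra fun h =>
          Finset.disjoint_left.1 (hcU.1 c hc) (Finset.mem_compl.2 h) hv
      rw [ht]
      simp [single_apply]
    · rw [uncons_cons_of_ne hb, if_neg]
      · simp
      · intro h
        refine hb (Finset.eq_of_subset_of_card_le ?_ (h3 b (by simp)))
        intro v hv
        rw [Finset.mem_compl]
        intro hvU
        exact Finset.notMem_empty v (h ▸ Finset.mem_inter.2 ⟨hv, hvU⟩)

/-- With no smaller first blocks present, `uncons A x` is a cycle on `d` blocks of `Aᶜ`. It bounds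
by exactness if `d < Aᶜ.card`, vanishes by the cocycle condition for `U = Aᶜ` in the top degree, and
vanishes for lack of partitions beyond it. -/
theorem exists_boundary_eq_uncons {d : ℕ} {x : Chains β F}
    (h0 : torusBoundary x = 0)
    (h1 : ∀ U : Finset β, U.card = d → torusCocycle U U.toList x = 0) (A : Finset β)
    (hx : x ∈ headChains F Finset.univ (d + 1) (A.card ≤ Finset.card ·)) :
    ∃ y ∈ partitionChains F (Finset.univ \ A) (d + 1), boundary y = uncons A x := by
  have hx' := headChains_le _ _ _ hx
  have h2 : boundary (uncons A x) = 0 := by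
    rw [← neg_eq_zero, ← uncons_torusBoundary
      (headChains_mono (fun b hb h => ((Finset.card_lt_card h).not_ge hb)) hx), h0, map_zero]
  have h3 := uncons_mem (a := A) hx'
  rcases lt_trichotomy d (Finset.univ \ A).card with h | h | h
  · exact exists_boundary_eq h h3 h2
  · refine ⟨0, zero_mem _, ?_⟩
    rw [map_zero, eq_comm]
    have hU : Aᶜ.card = d := by rw [h, Finset.compl_eq_univ_sdiff]
    refine eq_zero_of_boundary_eq_zero (Finset.nodup_toList Aᶜ) ?_ h2 ?_
    · rwa [Finset.toList_toFinset, Finset.length_toList, hU, Finset.compl_eq_univ_sdiff]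
    · have h4 := torusCocycle_eq_uncons_apply Aᶜ Aᶜ.toList (x := x) (by rwa [compl_compl])
      rw [h1 _ hU, compl_compl] at h4
      exact h4.symm
  · rw [partitionChains_eq_bot h, Submodule.mem_bot] at h3
    exact ⟨0, zero_mem _, by rw [h3, map_zero]⟩

theorem torusBoundary_torusBoundary {p : ℕ} {x : Chains β F}
    (hx : x ∈ partitionChains F Finset.univ (p + 2)) : torusBoundary (torusBoundary x) = 0 := by
  cases p with
  | succ p => exact torusBoundary_torusBoundary_of_three_le hx
  -- From two blocks the identities between merges are not available, but one-block lists have zero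
  -- boundary.
  | zero => exact torusBoundary_eq_zero_of_length_one (torusBoundary_mem hx)

/-- Induction up the filtration: `j` bounds the size of first blocks from below, and `t` bounds the
number of layers left. Each step clears the layer of size `j` by adding a boundary. -/
theorem exists_torusBoundary_eq_of_headChains {d : ℕ} (t : ℕ) {j : ℕ} (hj : j ≠ 0)
    (htj : Fintype.card β < t + j) {x : Chains β F}
    (hx : x ∈ headChains F Finset.univ (d + 1) (j ≤ Finset.card ·)) (h0 : torusBoundary x = 0)
    (h1 : ∀ U : Finset β, U.card = d → torusCocycle U U.toList x = 0) :
    ∃ y ∈ partitionChains F Finset.univ (d + 2), torusBoundary y = x := by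
  induction t generalizing j x with
  | zero =>
    refine ⟨0, zero_mem _, ?_⟩
    rw [map_zero, eq_comm]
    refine eq_of_mem_supported (f := LinearMap.id) (g := 0) (fun l hl => ?_) hx
    obtain ⟨-, h2, h3⟩ := hl
    cases l with
    | nil => simp at h2
    | cons b l =>
      have := h3 b (by simp)
      have := Finset.card_le_univ b
      omega
  | succ t ih =>
    have key : ∀ A : Finset β, ∃ y : Chains β F, A ∈ Finset.univ.powersetCard j →
        y ∈ partitionChains F (Finset.univ \ A) (d + 1) ∧ boundary y = uncons A x := by
      intro A
      by_cases hA : A ∈ Finset.univ.powersetCard j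
      · rw [Finset.mem_powersetCard_univ] at hA
        obtain ⟨y, hy, hy'⟩ := exists_boundary_eq_uncons h0 h1 A (hA ▸ hx)
        exact ⟨y, fun _ => ⟨hy, hy'⟩⟩
      · exact ⟨0, fun h => absurd h hA⟩
    choose y hy using key
    have hne : ∀ A ∈ Finset.univ.powersetCard j, (A : Finset β).Nonempty := fun A hA => by
      rw [Finset.mem_powersetCard_univ] at hA
      rw [← Finset.card_pos]
      omega
    -- The tail part of `torusBoundary z` is minus the layer of `x` of size `j`; the remaining terms
    -- have larger first blocks.
    set z : Chains β F := ∑ A ∈ Finset.univ.powersetCard j, cons A (y A) with hz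
    have hzmem : z ∈ partitionChains F Finset.univ (d + 2) :=
      sum_mem fun A hA => cons_mem (hne A hA) (Finset.subset_univ A) (hy A hA).1
    have hzx : x + torusBoundary z ∈
        headChains F Finset.univ (d + 1) (j + 1 ≤ Finset.card ·) := by
      have : x + torusBoundary z =
          (x - ∑ A ∈ Finset.univ.powersetCard j, cons A (uncons A x)) +
            ∑ A ∈ Finset.univ.powersetCard j, (mergeHead A (y A) + wrapHead A (y A)) := by
        rw [hz, map_sum, sub_add, sub_eq_add_neg, ← Finset.sum_sub_distrib,
          ← Finset.sum_neg_distrib]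
        congr 1
        refine Finset.sum_congr rfl fun A hA => ?_
        rw [torusBoundary_cons, (hy A hA).2]
        abel
      rw [this]
      refine add_mem (sub_sum_cons_uncons_mem hx) (sum_mem fun A hA => ?_)
      have hA' := Finset.mem_powersetCard_univ.1 hA
      exact headChains_mono (fun b hb => hA' ▸ Finset.card_lt_card hb)
        (add_mem (mergeHead_mem_headChains (hne A hA) (Finset.subset_univ A) (hy A hA).1)
          (wrapHead_mem_headChains (hne A hA) (Finset.subset_univ A) (hy A hA).1))
    obtain ⟨w, hw, hwx⟩ := ih (by omega) (by omega) hzx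
      (by rw [map_add, h0, torusBoundary_torusBoundary hzmem, add_zero])
      (fun U hU => by rw [map_add, h1 U hU, torusCocycle_torusBoundary U _ hzmem, add_zero])
    exact ⟨w - z, sub_mem hw hzmem, by rw [map_sub, hwx, add_sub_cancel_right]⟩

theorem exists_torusBoundary_eq {d : ℕ} {x : Chains β F}
    (hx : x ∈ partitionChains F Finset.univ (d + 1)) (h0 : torusBoundary x = 0)
    (h1 : ∀ U : Finset β, U.card = d → torusCocycle U U.toList x = 0) :
    ∃ y ∈ partitionChains F Finset.univ (d + 2), torusBoundary y = x :=
  exists_torusBoundary_eq_of_headChains (Fintype.card β) (j := 1) one_ne_zero (by omega)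
    (partitionChains_le_headChains (fun _ hb => hb.card_pos) hx) h0 h1

/-- The cycle of all orderings of `U` after the block `Uᶜ`. -/
noncomputable def fundamentalCycle (U : Finset β) : Chains β F := cons Uᶜ (orderings U.toList)

theorem fundamentalCycle_mem {U : Finset β} (hU : U.card < Fintype.card β) :
    (fundamentalCycle U : Chains β F) ∈ partitionChains F Finset.univ (U.card + 1) := by
  refine cons_mem ?_ (Finset.subset_univ _) ?_
  · rw [← Finset.card_pos, Finset.card_compl]
    omega
  · have := orderings_mem (F := F) (Finset.nodup_toList U)
    rw [Finset.toList_toFinset, Finset.length_toList] at this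
    rwa [← Finset.compl_eq_univ_sdiff, compl_compl]

theorem torusBoundary_fundamentalCycle (U : Finset β) :
    torusBoundary (fundamentalCycle U : Chains β F) = 0 :=
  torusBoundary_cons_orderings _ _

/-- The cocycle requires `Vᶜ` to be disjoint from `U`, that is `U ⊆ V`, which for equal
cardinalities means `U = V`. -/
theorem torusCocycle_fundamentalCycle {U V : Finset β} (h : U.card = V.card) :
    torusCocycle U U.toList (fundamentalCycle V : Chains β F) = if V = U then 1 else 0 := by
  rw [fundamentalCycle, torusCocycle_cons]
  by_cases hUV : V = U
  · subst hUV
    rw [if_pos (Finset.disjoint_iff_inter_eq_empty.1 disjoint_compl_left), if_pos rfl,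
      tailCocycle_orderings (Finset.nodup_toList _) (by simp)]
  · rw [if_neg hUV, if_neg]
    intro h'
    refine hUV (Finset.eq_of_subset_of_card_le ?_ h.ge).symm
    intro v hv
    by_contra hv'
    exact Finset.notMem_empty v (h' ▸ Finset.mem_inter.2 ⟨Finset.mem_compl.2 hv', hv⟩)

end Exactness

end BlockList

namespace Hypergraph

open BlockList

/-! ### Reduction of a star hypergraph to the vertices outside its core -/

section Star

variable {α : Type*} {H : Hypergraph α} {S : Set α}

/-- The hyperedges of `H` are the sets obtained from the nonempty set `S` by adding one of the
other vertices. -/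
structure IsStarWithCore (H : Hypergraph α) (S : Set α) : Prop where
  subset : S ⊆ H.vertexSet
  nonempty : S.Nonempty
  mem_edgeSet_iff : ∀ e, e ∈ H.edgeSet ↔ ∃ v ∈ H.vertexSet \ S, e = insert v S

/-- Uniformity leaves one vertex of each hyperedge outside `S`, and the absence of isolated vertices
makes every outer vertex occur. The bound `2 ≤ k` makes `S` nonempty, so that it can mark a block.
-/
theorem IsStar.exists_isStarWithCore {k : ℕ} (hk : 2 ≤ k) (hH : H.IsStar k) :
    ∃ S : Set α, S.encard + 1 = k ∧ H.IsStarWithCore S := by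
  obtain ⟨S, hSV, hSk, hS⟩ := hH.common
  have hfin : S.encard ≠ ⊤ := fun h => by simp [h] at hSk
  have key : ∀ e ∈ H.edgeSet, ∃ v ∈ H.vertexSet \ S, e = insert v S := by
    intro e he
    have h1 := Set.encard_sdiff_add_encard_of_subset (hS e he)
    rw [hH.uniform e he, ← hSk, add_comm S.encard] at h1
    obtain ⟨v, hv⟩ := Set.encard_eq_one.1 (WithTop.add_right_cancel hfin h1)
    have hve : v ∈ e \ S := hv ▸ Set.mem_singleton v
    refine ⟨v, ⟨H.subset_vertexSet_of_mem_edgeSet' he hve.1, hve.2⟩, ?_⟩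
    rw [Set.insert_eq, ← hv, Set.sdiff_union_of_subset (hS e he)]
  refine ⟨S, hSk, hSV, ?_, fun e => ⟨key e, ?_⟩⟩
  · rw [Set.nonempty_iff_ne_empty]
    rintro rfl
    rw [Set.encard_empty, zero_add] at hSk
    have : k = 1 := by exact_mod_cast hSk.symm
    omega
  · rintro ⟨v, hv, rfl⟩
    obtain ⟨e, he, hve⟩ := hH.no_singleton v hv.1
    obtain ⟨w, hw, rfl⟩ := key e he
    obtain rfl : v = w := by
      rcases hve with h | h
      · exact h
      · exact absurd h hv.2
    exact he

/-- A vertex outside `S`, as a vertex. -/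
def outerVertex (v : ↥(H.vertexSet \ S)) : H.vertexSet := ⟨v, v.2.1⟩

/-- A chosen vertex in `S`. -/
noncomputable def IsStarWithCore.center (hS : H.IsStarWithCore S) : H.vertexSet :=
  ⟨hS.nonempty.some, hS.subset hS.nonempty.some_mem⟩

theorem IsStarWithCore.exists_block_eq (hS : H.IsStarWithCore S) {m : ℕ}
    (B : H.OrderedPartition m) :
    (∀ v : H.vertexSet, (v : α) ∈ S → B.block v = B.block hS.center) ∧
      ∃ v : ↥(H.vertexSet \ S), B.block (outerVertex v) = B.block hS.center := by
  obtain ⟨e, he, i, hi⟩ := B.exists_edge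
  obtain ⟨w, hw, rfl⟩ := (hS.mem_edgeSet_iff e).1 he
  have hc : B.block hS.center = i := hi _ (Set.mem_insert_of_mem _ hS.nonempty.some_mem)
  rw [hc]
  exact ⟨fun v hv => hi _ (Set.mem_insert_of_mem _ hv), ⟨w, hw⟩, hi _ (Set.mem_insert _ _)⟩

/-- Deleting `S` empties no block, since the block with `S` contains a hyperedge and hence an outer
vertex. -/
theorem IsStarWithCore.surjective_block_outerVertex (hS : H.IsStarWithCore S) {m : ℕ}
    (B : H.OrderedPartition m) :
    Function.Surjective fun v : ↥(H.vertexSet \ S) => B.block (outerVertex v) := by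
  obtain ⟨h1, v, hv⟩ := hS.exists_block_eq B
  intro i
  obtain ⟨w, rfl⟩ := B.surjective i
  by_cases hw : (w : α) ∈ S
  · exact ⟨v, hv.trans (h1 w hw).symm⟩
  · exact ⟨⟨w, w.2, hw⟩, rfl⟩

open scoped Classical in
/-- The ordered partition with `S` in the first block and the other vertices distributed
by a surjection. -/
noncomputable def IsStarWithCore.ofSurjective (hS : H.IsStarWithCore S) {m : ℕ}
    (g : ↥(H.vertexSet \ S) → Fin (m + 1)) (hg : Function.Surjective g) :
    H.OrderedPartition (m + 1) where
  block v := if hv : (v : α) ∈ S then 0 else g ⟨v, v.2, hv⟩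
  surjective i := by
    obtain ⟨v, hv⟩ := hg i
    exact ⟨outerVertex v, (dif_neg v.2.2).trans hv⟩
  exists_edge := by
    obtain ⟨v, hv⟩ := hg 0
    refine ⟨insert (v : α) S, (hS.mem_edgeSet_iff _).2 ⟨v, v.2, rfl⟩, 0, fun w hw => ?_⟩
    split_ifs with hwS
    · rfl
    · rw [← hv]
      congr 1
      exact Subtype.ext (hw.resolve_right hwS)

theorem IsStarWithCore.ofSurjective_block_center (hS : H.IsStarWithCore S) {m : ℕ}
    (g : ↥(H.vertexSet \ S) → Fin (m + 1)) (hg : Function.Surjective g) :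
    (hS.ofSurjective g hg).block hS.center = 0 :=
  dif_pos hS.nonempty.some_mem

theorem IsStarWithCore.ofSurjective_block_outerVertex (hS : H.IsStarWithCore S) {m : ℕ}
    (g : ↥(H.vertexSet \ S) → Fin (m + 1)) (hg : Function.Surjective g)
    (v : ↥(H.vertexSet \ S)) : (hS.ofSurjective g hg).block (outerVertex v) = g v :=
  dif_neg v.2.2

theorem IsStarWithCore.eq_ofSurjective (hS : H.IsStarWithCore S) {m : ℕ}
    (B : H.OrderedPartition (m + 1)) (hB : B.block hS.center = 0) :
    B = hS.ofSurjective _ (hS.surjective_block_outerVertex B) := by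
  ext v : 2
  simp only [ofSurjective]
  split_ifs with hv
  · rw [(hS.exists_block_eq B).1 v hv, hB]
  · rfl

/-- Every merge, including the cyclic one, fixes the index `0`, so `S` stays in the first block and
no rotation or sign intervenes. -/
theorem IsStarWithCore.ofSurjective_merge (hS : H.IsStarWithCore S) {m : ℕ}
    (g : ↥(H.vertexSet \ S) → Fin (m + 2)) (hg : Function.Surjective g) (i : Fin (m + 2)) :
    (hS.ofSurjective g hg).merge i =
      hS.ofSurjective (mergeIndex i ∘ g) ((mergeIndex_surjective i).comp hg) := by
  ext v : 2
  simp only [OrderedPartition.merge, OrderedPartition.map, Function.comp_apply, ofSurjective]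
  split_ifs with hv
  · simp [mergeIndex]
  · rfl

theorem rotate_block {m : ℕ} (B : H.OrderedPartition (m + 1)) (v : H.vertexSet) :
    B.rotate.block v = B.block v - 1 :=
  finRotate_symm_apply _

open scoped Fin.CommRing in
theorem rotate_iterate_block {m : ℕ} (B : H.OrderedPartition (m + 1)) (v : H.vertexSet)
    (j : ℕ) : (OrderedPartition.rotate^[j] B).block v = B.block v - (j : Fin (m + 1)) := by
  induction j with
  | zero => simp
  | succ j ih => rw [Function.iterate_succ_apply', rotate_block, ih, Nat.cast_succ]; abel

open scoped Fin.CommRing in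
theorem rotate_iterate_self {m : ℕ} (B : H.OrderedPartition (m + 1)) :
    OrderedPartition.rotate^[m + 1] B = B := by
  ext v : 2
  rw [rotate_iterate_block, Fin.natCast_self, sub_zero]

/-! ### Cyclic chains as chains on ordered partitions of the outer vertices -/

variable (F : Type*) [Field F]

theorem cyclicClass_rotate_iterate {m : ℕ} (B : H.OrderedPartition m) (j : ℕ) :
    H.cyclicClass F (OrderedPartition.rotate^[j] B) =
      ((-1 : F) ^ (m + 1)) ^ j • H.cyclicClass F B := by
  induction j with
  | zero => simp
  | succ j ih =>
    rw [Function.iterate_succ_apply', cyclicClass_rotate, ih, smul_smul, ← pow_succ']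

theorem IsStarWithCore.span_cyclicClass (hS : H.IsStarWithCore S) (m : ℕ) :
    Submodule.span F (Set.range fun g : {g : ↥(H.vertexSet \ S) → Fin (m + 1) //
      Function.Surjective g} => H.cyclicClass F (hS.ofSurjective g.1 g.2)) = ⊤ := by
  rw [eq_top_iff]
  rintro x -
  obtain ⟨y, rfl⟩ := Submodule.mkQ_surjective _ x
  induction y using Finsupp.induction_linear with
  | zero => simp
  | add y z hy hz => rw [map_add]; exact add_mem hy hz
  | single B c =>
    have h1 : (H.cyclicRelations F (m + 1)).mkQ (Finsupp.single B c) =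
        c • H.cyclicClass F B := by
      rw [cyclicClass, ← map_smul, Finsupp.smul_single, smul_eq_mul, mul_one]
    rw [h1]
    refine Submodule.smul_mem _ _ ?_
    set j : ℕ := (B.block hS.center : ℕ)
    have h2 := cyclicClass_rotate_iterate F B j
    have h3 : (OrderedPartition.rotate^[j] B).block hS.center = 0 := by
      rw [rotate_iterate_block, Fin.cast_val_eq_self, sub_self]
    have h4 : H.cyclicClass F B =
        ((-1 : F) ^ (m + 1 + 1)) ^ j • H.cyclicClass F (OrderedPartition.rotate^[j] B) := by
      rw [h2, smul_smul, ← mul_pow, ← mul_pow]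
      simp
    rw [h4, hS.eq_ofSurjective _ h3]
    exact Submodule.smul_mem _ _ (Submodule.subset_span
      ⟨⟨_, hS.surjective_block_outerVertex _⟩, rfl⟩)

variable [Fintype ↥(H.vertexSet \ S)]

/-- The list of blocks, without the vertices in `S`, of an ordered partition that is first rotated
so that its first block contains `S`, with the sign of this rotation. -/
noncomputable def IsStarWithCore.blockChain (hS : H.IsStarWithCore S) {m : ℕ}
    (B : H.OrderedPartition (m + 1)) : Chains ↥(H.vertexSet \ S) F :=
  ((-1 : F) ^ (m + 1 + 1)) ^ (B.block hS.center : ℕ) • basisChain (fiberList fun v =>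
    (OrderedPartition.rotate^[(B.block hS.center : ℕ)] B).block (outerVertex v))

theorem IsStarWithCore.blockChain_rotate (hS : H.IsStarWithCore S) {m : ℕ}
    (B : H.OrderedPartition (m + 1)) :
    hS.blockChain F B = (-1 : F) ^ (m + 1 + 1) • hS.blockChain F B.rotate := by
  by_cases h : B.block hS.center = 0
  · have h1 : (B.rotate.block hS.center : ℕ) = m := by
      rw [rotate_block, h, zero_sub, Fin.coe_neg_one]
    simp only [blockChain, h1, h, Fin.val_zero, pow_zero, one_smul, Function.iterate_zero, id,
      smul_smul]
    -- A full turn of the `m + 1` blocks has sign exponent `(m + 1) * (m + 2)`, which is even; this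
    -- is why no normalised class is forced to vanish.
    rw [← Function.iterate_succ_apply, rotate_iterate_self, ← pow_succ', ← pow_mul,
      mul_comm, Even.neg_one_pow (Nat.even_mul_succ_self (m + 1)), one_smul]
  · have h1 : (B.block hS.center : ℕ) = (B.rotate.block hS.center : ℕ) + 1 := by
      rw [rotate_block, Fin.val_sub_one_of_ne_zero h]
      have : (B.block hS.center : ℕ) ≠ 0 := fun h' => h (Fin.ext h')
      omega
    simp only [blockChain, h1, Function.iterate_succ_apply, pow_succ', smul_smul]

/-- The embedding of the cyclic chains into the chains on lists of blocks. -/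
noncomputable def IsStarWithCore.toChains (hS : H.IsStarWithCore S) (m : ℕ) :
    H.CyclicChain F (m + 1) →ₗ[F] Chains ↥(H.vertexSet \ S) F :=
  (H.cyclicRelations F (m + 1)).liftQ (Finsupp.linearCombination F (hS.blockChain F)) <| by
    rw [cyclicRelations, Submodule.span_le]
    rintro _ ⟨B, rfl⟩
    simp only [SetLike.mem_coe, LinearMap.mem_ker, map_sub, map_smul,
      Finsupp.linearCombination_single, one_smul]
    rw [sub_eq_zero]
    exact hS.blockChain_rotate F B

theorem IsStarWithCore.toChains_cyclicClass (hS : H.IsStarWithCore S) {m : ℕ}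
    (g : ↥(H.vertexSet \ S) → Fin (m + 1)) (hg : Function.Surjective g) :
    hS.toChains F m (H.cyclicClass F (hS.ofSurjective g hg)) = basisChain (fiberList g) := by
  simp only [toChains, cyclicClass, Submodule.mkQ_apply, Submodule.liftQ_apply,
    Finsupp.linearCombination_single, one_smul, blockChain, ofSurjective_block_center,
    Fin.val_zero, pow_zero, Function.iterate_zero, id, ofSurjective_block_outerVertex]

/-- The normalised classes span and are sent to distinct basis lists. -/
theorem IsStarWithCore.toChains_injective (hS : H.IsStarWithCore S) (m : ℕ) :
    Function.Injective (hS.toChains F m) := by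
  rw [← LinearMap.ker_eq_bot, LinearMap.ker_eq_bot']
  intro x hx
  have hx' : x ∈ Submodule.span F (Set.range fun g : {g : ↥(H.vertexSet \ S) → Fin (m + 1) //
      Function.Surjective g} => H.cyclicClass F (hS.ofSurjective g.1 g.2)) := by
    rw [hS.span_cyclicClass F]
    trivial
  rw [← Finsupp.range_linearCombination] at hx'
  obtain ⟨y, rfl⟩ := hx'
  have h1 : Finsupp.mapDomain (fun g : {g : ↥(H.vertexSet \ S) → Fin (m + 1) //
      Function.Surjective g} => fiberList g.1) y = 0 := by
    rw [← hx, Finsupp.apply_linearCombination, Finsupp.mapDomain, Finsupp.linearCombination_apply]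
    refine Finsupp.sum_congr fun g _ => ?_
    rw [Function.comp_apply, toChains_cyclicClass F, Finsupp.smul_single, smul_eq_mul, mul_one]
  have h2 : y = 0 := Finsupp.mapDomain_injective
    ((fiberList_injective (m + 1)).comp Subtype.val_injective)
    (by rw [Finsupp.mapDomain_zero]; exact h1)
  rw [h2, map_zero]

variable [DecidableEq ↥(H.vertexSet \ S)]

theorem IsStarWithCore.range_toChains (hS : H.IsStarWithCore S) (m : ℕ) :
    LinearMap.range (hS.toChains F m) = partitionChains F Finset.univ (m + 1) := by
  apply le_antisymm
  · rw [LinearMap.range_eq_map, ← hS.span_cyclicClass F, Submodule.map_span, Submodule.span_le]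
    rintro _ ⟨_, ⟨g, rfl⟩, rfl⟩
    simp only [toChains_cyclicClass F]
    exact basisChain_mem (isPartition_fiberList g.2) (by simp [fiberList])
  · intro x hx
    refine map_mem_of_mem_supported (f := LinearMap.id) (fun l hl => ?_) hx
    obtain ⟨g, hg, rfl⟩ := exists_fiberList_eq hl.1 hl.2
    exact ⟨_, hS.toChains_cyclicClass F g hg⟩

theorem IsStarWithCore.toChains_cyclicBoundary (hS : H.IsStarWithCore S) (m : ℕ)
    (x : H.CyclicChain F (m + 2)) :
    hS.toChains F m (H.cyclicBoundary F (m + 1) x) =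
      torusBoundary (hS.toChains F (m + 1) x) := by
  have hx : x ∈ Submodule.span F (Set.range fun g : {g : ↥(H.vertexSet \ S) → Fin (m + 1 + 1) //
      Function.Surjective g} => H.cyclicClass F (hS.ofSurjective g.1 g.2)) := by
    rw [hS.span_cyclicClass F]
    trivial
  refine LinearMap.eqOn_span (f := hS.toChains F m ∘ₗ H.cyclicBoundary F (m + 1))
    (g := torusBoundary ∘ₗ hS.toChains F (m + 1)) ?_ hx
  rintro _ ⟨g, rfl⟩
  simp only [LinearMap.comp_apply, cyclicBoundary_cyclicClass, map_sum, map_smul,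
    toChains_cyclicClass F, torusBoundary_fiberList, ofSurjective_merge]

theorem IsStarWithCore.mem_cyclicCycles_iff (hS : H.IsStarWithCore S) (d : ℕ)
    (x : H.CyclicChain F (d + 1)) :
    x ∈ H.cyclicCycles F (d + 1) ↔ torusBoundary (hS.toChains F d x) = 0 := by
  cases d with
  | zero =>
    have h : hS.toChains F 0 x ∈ partitionChains F Finset.univ 1 := by
      rw [← hS.range_toChains F]
      exact ⟨x, rfl⟩
    simp [cyclicCycles, cyclicBoundary, torusBoundary_eq_zero_of_length_one h]
  | succ d =>
    rw [← hS.toChains_cyclicBoundary F, cyclicCycles, LinearMap.mem_ker,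
      map_eq_zero_iff _ (hS.toChains_injective F d)]

/-- The values of the cocycles on cycles. -/
noncomputable def IsStarWithCore.period (hS : H.IsStarWithCore S) (d : ℕ) :
    H.cyclicCycles F (d + 1) →ₗ[F] ({U : Finset ↥(H.vertexSet \ S) // U.card = d} → F) :=
  LinearMap.pi fun U =>
    torusCocycle U.1 U.1.toList ∘ₗ hS.toChains F d ∘ₗ (H.cyclicCycles F (d + 1)).subtype

/-- One inclusion is the cocycle property, the other is `exists_torusBoundary_eq`, both transported
along `toChains`. -/
theorem IsStarWithCore.ker_period (hS : H.IsStarWithCore S) (d : ℕ) :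
    LinearMap.ker (hS.period F d) =
      (LinearMap.range (H.cyclicBoundary F (d + 1))).submoduleOf (H.cyclicCycles F (d + 1)) := by
  ext ⟨x, hx⟩
  rw [LinearMap.mem_ker, Submodule.submoduleOf, Submodule.mem_comap, funext_iff]
  simp only [period, LinearMap.pi_apply, LinearMap.comp_apply, Submodule.subtype_apply,
    Pi.zero_apply, Subtype.forall, LinearMap.mem_range]
  constructor
  · intro h
    have hmem : hS.toChains F d x ∈ partitionChains F Finset.univ (d + 1) := by
      rw [← hS.range_toChains F]
      exact ⟨x, rfl⟩
    obtain ⟨y, hy, hyx⟩ := exists_torusBoundary_eq hmem ((hS.mem_cyclicCycles_iff F d x).1 hx) h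
    rw [← hS.range_toChains F] at hy
    obtain ⟨y, rfl⟩ := hy
    refine ⟨y, hS.toChains_injective F d ?_⟩
    rw [toChains_cyclicBoundary F, hyx]
  · rintro ⟨y, rfl⟩ U -
    rw [toChains_cyclicBoundary F]
    refine torusCocycle_torusBoundary U _ (p := d + 2) (V := Finset.univ) ?_
    rw [← hS.range_toChains F]
    exact ⟨y, rfl⟩

theorem IsStarWithCore.period_surjective (hS : H.IsStarWithCore S) {d : ℕ}
    (hd : d < Fintype.card ↥(H.vertexSet \ S)) : Function.Surjective (hS.period F d) := by
  -- Fundamental cycles map to the standard basis. They exist because `d` is less than the number of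
  -- outer vertices, which leaves the first block `Uᶜ` nonempty.
  rw [← LinearMap.range_eq_top, eq_top_iff, ← (Pi.basisFun F _).span_eq, Submodule.span_le]
  rintro _ ⟨⟨U, rfl⟩, rfl⟩
  have h := fundamentalCycle_mem (F := F) hd
  rw [← hS.range_toChains F] at h
  obtain ⟨x, hx⟩ := h
  refine ⟨⟨x, (hS.mem_cyclicCycles_iff F _ x).2 (by rw [hx, torusBoundary_fundamentalCycle])⟩, ?_⟩
  ext ⟨V, hV⟩
  simp only [period, LinearMap.pi_apply, LinearMap.comp_apply, Submodule.subtype_apply, hx,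
    torusCocycle_fundamentalCycle hV, Pi.basisFun_apply, Pi.single_apply, Subtype.mk.injEq]
  simp only [eq_comm]

theorem IsStarWithCore.finrank_cyclicHomologyAtBlocks (hS : H.IsStarWithCore S) {d : ℕ}
    (hd : d < Fintype.card ↥(H.vertexSet \ S)) :
    Module.finrank F (H.CyclicHomologyAtBlocks F (d + 1)) =
      (Fintype.card ↥(H.vertexSet \ S)).choose d := by
  rw [((Submodule.quotEquivOfEq _ _ (hS.ker_period F d).symm).trans
    ((hS.period F d).quotKerEquivOfSurjective (hS.period_surjective F hd))).finrank_eq,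
    Module.finrank_fintype_fun_eq_card, Fintype.card_finset_len]

end Star

end Hypergraph

open Hypergraph in
theorem theorem4p1 {α : Type*} (F : Type*) [Field F] [CharZero F]
    (n k : ℕ) (hk : 2 ≤ k) (H : Hypergraph α) (hn : H.vertexSet.encard = n)
    (hH : H.IsStar k) (r : ℤ) (hr : -1 ≤ r) (hrn : r ≤ (n : ℤ) - k - 1) :
    Module.finrank F (H.CyclicHomology F r) = Nat.choose (n - k + 1) (r + 1).toNat := by
  classical
  obtain ⟨S, hSk, hS⟩ := hH.exists_isStarWithCore hk
  have hfin : H.vertexSet.Finite := Set.finite_of_encard_eq_coe hn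
  have : Fintype ↥(H.vertexSet \ S) := (hfin.subset Set.sdiff_subset).fintype
  have hcard : Fintype.card ↥(H.vertexSet \ S) = n - k + 1 := by
    have h1 := Set.encard_sdiff_add_encard_of_subset hS.subset
    rw [hn, ← Set.coe_fintypeCard, ← (hfin.subset hS.subset).cast_ncard_eq] at h1
    rw [← (hfin.subset hS.subset).cast_ncard_eq] at hSk
    norm_cast at h1 hSk
    -- The natural subtraction `n - k` is harmless: `hr` and `hrn` give `k ≤ n`.
    omega
  -- Degree `r` means `r + 2 = d + 1` blocks, that is, cells of dimension `d` in the torus.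
  obtain ⟨d, rfl⟩ : ∃ d : ℕ, r = (d : ℤ) - 1 := ⟨(r + 1).toNat, by omega⟩
  have h2 : ((d : ℤ) - 1 + 2).toNat = d + 1 := by omega
  have h3 : ((d : ℤ) - 1 + 1).toNat = d := by omega
  change Module.finrank F (H.CyclicHomologyAtBlocks F ((d : ℤ) - 1 + 2).toNat) = _
  rw [h2, h3, ← hcard]
  exact hS.finrank_cyclicHomologyAtBlocks F (by omega)
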